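/- Let $A$ and $B$ be non-trivial finite-dimensional quantum systems of dimensions $d_A,d_B$ with fixed orthonormal bases, let $\mathcal N$ be a quantum channel (completely positive trace-preserving map) and $\mathcal M$ a completely positive map from operators on $A$ to operators on $B$, let $H$ be a Hermitian operator on $A$, $E\in\mathbb R$ and $\alpha\in(0,1)\cup(1,\infty)$. For a state $\rho$ and $\sigma\ge 0$ on the same system, put $$Q_\alpha^M(\rho\Vert\sigma)=\inf_{(\Lambda_x)}\sum_x \operatorname{Tr}[\Lambda_x\rho]^\alpha\operatorname{Tr}[\Lambda_x\sigma]^{1-\alpha}\quad(\alpha<1),$$ and the same with $\sup$ in place of $\inf$ for $\alpha>1$, over all POVMs with finitely many outcomes (for $\alpha>1$ a term with $\operatorname{Tr}[\Lambda_x\sigma]=0$ is $+\infty$ if $\operatorname{Tr}[\Lambda_x\rho]>0$ and $0$ otherwise). Let $$Q^M_{\alpha,H,E}(\mathcal N\Vert\mathcal M)=\inf_{R',\ \rho_{R'A}}Q^M_\alpha\big((\mathrm{id}_{R'}\otimes\mathcal N)(\rho_{R'A})\,\big\Vert\,(\mathrm{id}_{R'}\otimes\mathcal M)(\rho_{R'A})\big)\quad(\alpha<1),$$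 and the same with $\sup$ for $\alpha>1$, over all finite-dimensional systems $R'$ and all states $\rho_{R'A}$ with $\operatorname{Tr}[H\rho_A]\le E$. Let $\Gamma^{\mathcal N}=\sum_{i,j}|i\rangle\langle j|\otimes\mathcal N(|i\rangle\langle j|)$ and $\Gamma^{\mathcal M}=\sum_{i,j}|i\rangle\langle j|\otimes\mathcal M(|i\rangle\langle j|)$ be the Choi operators, let $H^{T}$ be the transpose of $H$ in the same basis (so $H^T=H$ if, for example, this basis is an eigenbasis of $H$), and for positive definite $X,Y$ let $G_t(X,Y)=X^{1/2}(X^{-1/2}YX^{-1/2})^tX^{1/2}$. Assume that, if there is a density operator $\rho$ on $A$ with $\operatorname{Tr}[H\rho]\le E$ at all, then there is a positive definite one (this excludes only the case that $E$ is the least eigenvalue of $H$ and $H$ is not a multiple of the identity). Infima and suprema are taken in $[-\infty,+\infty]$, and those over the empty set are $+\infty$ and $-\infty$, respectively. For $\alpha\in(0,1/2)$, $$Q^M_{\alpha,H,E}(\mathcal N\Vert\mathcal M)=\inf_{\Omega,\Theta,\rho>0}\Big\{\alpha\operatorname{Tr}[\Omega\Gamma^{\mathcal N}]+(1-\alpha)\operatorname{Tr}[\Theta\Gamma^{\mathcal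 M}]:\ \operatorname{Tr}[\rho]=1,\ \operatorname{Tr}[H^{T}\rho]\le E,\ \Theta\ge G_{\frac{\alpha}{\alpha-1}}(\rho\otimes I,\Omega)\Big\};$$ for $\alpha\in[1/2,1)$, $$Q^M_{\alpha,H,E}(\mathcal N\Vert\mathcal M)=\inf_{\Omega,\Theta,\rho>0}\Big\{\alpha\operatorname{Tr}[\Theta\Gamma^{\mathcal N}]+(1-\alpha)\operatorname{Tr}[\Omega\Gamma^{\mathcal M}]:\ \operatorname{Tr}[\rho]=1,\ \operatorname{Tr}[H^{T}\rho]\le E,\ \Theta\ge G_{1-\frac1\alpha}(\rho\otimes I,\Omega)\Big\};$$ and for $\alpha>1$, $$Q^M_{\alpha,H,E}(\mathcal N\Vert\mathcal M)=\sup_{\Omega,\Theta,\rho>0}\Big\{\alpha\operatorname{Tr}[\Theta\Gamma^{\mathcal N}]+(1-\alpha)\operatorname{Tr}[\Omega\Gamma^{\mathcal M}]:\ \operatorname{Tr}[\rho]=1,\ \operatorname{Tr}[H^{T}\rho]\le E,\ \Theta\le G_{1-\frac1\alpha}(\rho\otimes I,\Omega)\Big\}.$$ Moreover, for every rational $\alpha\in(0,1)\cup(1,\infty)$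 this quantity is the optimal value of a semidefinite program with few and small constraints. Namely, there is an absolute constant $C$ such that the following holds. Let $p$ and $q>0$ be coprime integers with $\frac pq=\frac{\alpha}{\alpha-1}$ if $\alpha<1/2$ and $\frac pq=1-\frac1\alpha$ if $\alpha\ge1/2$. Then there are finitely many linear matrix inequalities in $2\times2$ block form with integer coefficients, $c_X\otimes X+c_Y\otimes Y+c_T\otimes T+\sum_i c_i\otimes Z_i\ge0$ (with symmetric integer $2\times2$ matrices $c$), depending only on $\alpha$, such that for all $A,B,\mathcal N,\mathcal M,H,E$ as above the following program has optimal value $Q^M_{\alpha,H,E}(\mathcal N\Vert\mathcal M)$: over Hermitian $\rho$ on $A$ and Hermitian $\Omega,\Theta,Z_1,\dots,Z_k$ on $A\otimes B$, minimize (if $\alpha<1$) or maximize (if $\alpha>1$) the linear objective displayed above for that $\alpha$, subject to these inequalities at $X=\rho\otimes I$, $Y=\Omega$, $T=\Theta$, and to $\operatorname{Tr}[\rho]=1$ and $\operatorname{Tr}[H^{T}\rho]\le E$. Writing these last constraints also as matrix inequalities (multiples of the identity), the program has at most $C\,(1+\log_2 q)$, that is $O(\log_2 q)$, linear matrix inequalities,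 each of size $2d_Ad_B\times 2d_Ad_B$. -/

import Mathlib

open scoped Kronecker ENNReal ComplexOrder

namespace MeasuredRenyi

noncomputable section

/-! ### Powers and weighted geometric means of matrices -/

/-- The real power `X ^ t` of a positive definite matrix (functional calculus). -/
def mpow {n : Type} [Fintype n] [DecidableEq n] (X : Matrix n n ℂ) (t : ℝ) : Matrix n n ℂ :=
  cfc (fun x : ℝ => x ^ t) X

/-- The weighted geometric mean
`G_t(X, Y) = X^{1/2} (X^{-1/2} Y X^{-1/2})^t X^{1/2}` of positive definite matrices. -/
def geoMean {n : Type} [Fintype n] [DecidableEq n] (t : ℝ) (X Y : Matrix n n ℂ) :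
    Matrix n n ℂ :=
  mpow X (1 / 2) * mpow (mpow X (-(1 / 2)) * Y * mpow X (-(1 / 2))) t * mpow X (1 / 2)

/-! ### States, measurements, channels -/

/-- Density matrices. -/
def IsDensity {n : Type} [Fintype n] (ρ : Matrix n n ℂ) : Prop :=
  ρ.PosSemidef ∧ ρ.trace = 1

/-- Positive operator-valued measures with `k` outcomes. -/
def IsPOVM {n : Type} [Fintype n] [DecidableEq n] {k : ℕ} (Λ : Fin k → Matrix n n ℂ) : Prop :=
  (∀ x, (Λ x).PosSemidef) ∧ ∑ x, Λ x = 1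

/-- The map `id_R ⊗ N`, acting blockwise. -/
def ampliate {A B : Type} (R : Type) (N : Matrix A A ℂ →ₗ[ℂ] Matrix B B ℂ)
    (X : Matrix (R × A) (R × A) ℂ) : Matrix (R × B) (R × B) ℂ :=
  Matrix.of fun i j => N (Matrix.of fun a a' => X (i.1, a) (j.1, a')) i.2 j.2

/-- Complete positivity: every `id_k ⊗ N` preserves positive semi-definiteness. -/
def IsCompletelyPositive {A B : Type} [Fintype A] [Fintype B]
    (N : Matrix A A ℂ →ₗ[ℂ] Matrix B B ℂ) : Prop :=
  ∀ (k : ℕ) (X : Matrix (Fin k × A) (Fin k × A) ℂ),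
    X.PosSemidef → (ampliate (Fin k) N X).PosSemidef

/-- Quantum channels: completely positive trace-preserving maps. -/
def IsChannel {A B : Type} [Fintype A] [Fintype B]
    (N : Matrix A A ℂ →ₗ[ℂ] Matrix B B ℂ) : Prop :=
  IsCompletelyPositive N ∧ ∀ X, (N X).trace = X.trace

/-- The unnormalized maximally entangled operator `∑ i j, |i⟩⟨j| ⊗ |i⟩⟨j|`. -/
def maxEntangled (A : Type) [Fintype A] [DecidableEq A] : Matrix (A × A) (A × A) ℂ :=
  ∑ i : A, ∑ j : A, Matrix.single i j (1 : ℂ) ⊗ₖ Matrix.single i j (1 : ℂ)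

/-- The Choi operator `(id_R ⊗ N)(Γ_{RA})`, where `R` is a copy of `A`. -/
def choi {A B : Type} [Fintype A] [DecidableEq A] (N : Matrix A A ℂ →ₗ[ℂ] Matrix B B ℂ) :
    Matrix (A × B) (A × B) ℂ :=
  ampliate A N (maxEntangled A)

/-- The reduced operator on the second tensor factor. -/
def marginal {R A : Type} [Fintype R] (ρ : Matrix (R × A) (R × A) ℂ) : Matrix A A ℂ :=
  Matrix.of fun a a' => ∑ r, ρ (r, a) (r, a')

/-! ### Measured Rényi quasi-entropies -/

/-- `∑ x, Tr[Λ_x ρ]^α Tr[Λ_x σ]^{1-α}` in `[0, ∞]`. For `α > 1` a term with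
`Tr[Λ_x σ] = 0` is `∞` if `Tr[Λ_x ρ] > 0` and `0` if `Tr[Λ_x ρ] = 0`. -/
def outcomeQuasi {n : Type} [Fintype n] (α : ℝ) (ρ σ : Matrix n n ℂ) {k : ℕ}
    (Λ : Fin k → Matrix n n ℂ) : ℝ≥0∞ :=
  ∑ x, ENNReal.ofReal (Λ x * ρ).trace.re ^ α * ENNReal.ofReal (Λ x * σ).trace.re ^ (1 - α)

/-- The measured Rényi relative quasi-entropy `Q_α^M(ρ‖σ)`: an infimum (`α < 1`) or a supremum
(`α > 1`) over all finite alphabets and all POVMs. -/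
def stateQuasi {n : Type} [Fintype n] [DecidableEq n] (α : ℝ) (ρ σ : Matrix n n ℂ) : ℝ≥0∞ :=
  if α < 1 then
    ⨅ (k : ℕ) (Λ : Fin k → Matrix n n ℂ) (_ : IsPOVM Λ), outcomeQuasi α ρ σ Λ
  else
    ⨆ (k : ℕ) (Λ : Fin k → Matrix n n ℂ) (_ : IsPOVM Λ), outcomeQuasi α ρ σ Λ

/-- The energy-constrained measured Rényi quasi-divergence `Q_{α,H,E}^M(N‖M)`, optimized over
all dimensions of the reference system and all input states whose reduced state on the
channel input satisfies the energy constraint. -/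
def channelQuasi {A B : Type} [Fintype A] [Fintype B] [DecidableEq B] (α : ℝ)
    (H : Matrix A A ℂ) (E : ℝ) (N M : Matrix A A ℂ →ₗ[ℂ] Matrix B B ℂ) : EReal :=
  if α < 1 then
    ⨅ (k : ℕ) (ρ : Matrix (Fin k × A) (Fin k × A) ℂ)
      (_ : IsDensity ρ ∧ (H * marginal ρ).trace.re ≤ E),
      (stateQuasi α (ampliate (Fin k) N ρ) (ampliate (Fin k) M ρ) : EReal)
  else
    ⨆ (k : ℕ) (ρ : Matrix (Fin k × A) (Fin k × A) ℂ)
      (_ : IsDensity ρ ∧ (H * marginal ρ).trace.re ≤ E),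
      (stateQuasi α (ampliate (Fin k) N ρ) (ampliate (Fin k) M ρ) : EReal)

/-! ### Semidefinite programs -/

/-- A semidefinite program: a linear objective on a real vector space `V` of decision variables,
and one linear matrix inequality `const j + lin j x ≥ 0`, with Hermitian matrices indexed by `n`,
for each `j : J`. -/
structure SDP (V n J : Type) [AddCommGroup V] [Module ℝ V] where
  obj : V →ₗ[ℝ] ℝ
  const : J → Matrix n n ℂ
  lin : J → V →ₗ[ℝ] Matrix n n ℂ
  const_isHermitian : ∀ j, (const j).IsHermitian
  lin_isHermitian : ∀ j x, (lin j x).IsHermitian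

namespace SDP

variable {V n J : Type} [AddCommGroup V] [Module ℝ V]

/-- The points that satisfy all linear matrix inequalities. -/
def Feasible (P : SDP V n J) (x : V) : Prop :=
  ∀ j, (P.const j + P.lin j x).PosSemidef

/-- Optimal value of the minimization problem. -/
def minValue (P : SDP V n J) : EReal :=
  ⨅ (x : V) (_ : P.Feasible x), ((P.obj x : ℝ) : EReal)

/-- Optimal value of the maximization problem. -/
def maxValue (P : SDP V n J) : EReal :=
  ⨆ (x : V) (_ : P.Feasible x), ((P.obj x : ℝ) : EReal)

/-- The number of linear matrix inequalities. -/
def numLMI [Fintype J] (_ : SDP V n J) : ℕ := Fintype.card J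

/-- The size (number of rows) of each linear matrix inequality. -/
def sizeLMI [Fintype n] (_ : SDP V n J) : ℕ := Fintype.card n

end SDP

/-- The real vector space of Hermitian matrices. -/
abbrev Herm (n : Type) : Type := selfAdjoint (Matrix n n ℂ)

/-- Decision variables `(ρ, Ω, Θ, Z_1, …, Z_k)` of the channel programs. -/
abbrev ChannelVars (A B : Type) (k : ℕ) : Type :=
  Herm A × Herm (A × B) × Herm (A × B) × (Fin k → Herm (A × B))

/-- A homogeneous linear matrix inequality in `2 × 2` block form, with integer coefficients, in
matrix variables `X, Y, T, Z_1, …, Z_k`: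
`cX ⊗ X + cY ⊗ Y + cT ⊗ T + ∑ i, cZ i ⊗ Z i ≥ 0`. -/
structure BlockLMI (k : ℕ) where
  cX : Matrix (Fin 2) (Fin 2) ℤ
  cY : Matrix (Fin 2) (Fin 2) ℤ
  cT : Matrix (Fin 2) (Fin 2) ℤ
  cZ : Fin k → Matrix (Fin 2) (Fin 2) ℤ
  symmX : cX.IsSymm
  symmY : cY.IsSymm
  symmT : cT.IsSymm
  symmZ : ∀ i, (cZ i).IsSymm

/-- An integer matrix, with complex entries. -/
def toC (c : Matrix (Fin 2) (Fin 2) ℤ) : Matrix (Fin 2) (Fin 2) ℂ := c.map (fun z => (z : ℂ))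

theorem toC_isHermitian {c : Matrix (Fin 2) (Fin 2) ℤ} (h : c.IsSymm) :
    (toC c).IsHermitian := by
  ext i j
  have := congrFun (congrFun h i) j
  simp only [Matrix.transpose_apply] at this
  simp [toC, Matrix.conjTranspose_apply, this]

theorem kronecker_isHermitian {m n : Type} {a : Matrix m m ℂ} {b : Matrix n n ℂ}
    (ha : a.IsHermitian) (hb : b.IsHermitian) : (a ⊗ₖ b).IsHermitian := by
  unfold Matrix.IsHermitian
  rw [Matrix.conjTranspose_kronecker, ha.eq, hb.eq]

theorem herm_isHermitian {n : Type} (x : Herm n) : (x : Matrix n n ℂ).IsHermitian := x.2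

/-- The left-hand side of a block inequality at `X = ρ ⊗ I`, `Y = Ω`, `T = Θ`. -/
def BlockLMI.eval {A B : Type} [DecidableEq B] {k : ℕ} (L : BlockLMI k) :
    ChannelVars A B k →ₗ[ℝ] Matrix (Fin 2 × (A × B)) (Fin 2 × (A × B)) ℂ where
  toFun v :=
    toC L.cX ⊗ₖ ((v.1 : Matrix A A ℂ) ⊗ₖ (1 : Matrix B B ℂ))
      + toC L.cY ⊗ₖ (v.2.1 : Matrix (A × B) (A × B) ℂ)
      + toC L.cT ⊗ₖ (v.2.2.1 : Matrix (A × B) (A × B) ℂ)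
      + ∑ i, toC (L.cZ i) ⊗ₖ (v.2.2.2 i : Matrix (A × B) (A × B) ℂ)
  map_add' v w := by
    simp only [Prod.fst_add, Prod.snd_add, Pi.add_apply, AddSubgroup.coe_add,
      Matrix.add_kronecker, Matrix.kronecker_add, Finset.sum_add_distrib]
    abel
  map_smul' r v := by
    simp only [Prod.smul_fst, Prod.smul_snd, Pi.smul_apply, selfAdjoint.val_smul,
      Matrix.smul_kronecker, Matrix.kronecker_smul, RingHom.id_apply, smul_add, Finset.smul_sum]

theorem BlockLMI.eval_isHermitian {A B : Type} [DecidableEq B] {k : ℕ} (L : BlockLMI k)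
    (v : ChannelVars A B k) : (L.eval v).IsHermitian := by
  have hs : (∑ i, toC (L.cZ i) ⊗ₖ (v.2.2.2 i : Matrix (A × B) (A × B) ℂ)).IsHermitian := by
    unfold Matrix.IsHermitian
    rw [Matrix.conjTranspose_sum]
    exact Finset.sum_congr rfl fun i _ =>
      kronecker_isHermitian (toC_isHermitian (L.symmZ i)) (herm_isHermitian _)
  exact (((kronecker_isHermitian (toC_isHermitian L.symmX)
    (kronecker_isHermitian (herm_isHermitian _) Matrix.isHermitian_one)).add
    (kronecker_isHermitian (toC_isHermitian L.symmY) (herm_isHermitian _))).add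
    (kronecker_isHermitian (toC_isHermitian L.symmT) (herm_isHermitian _))).add hs

/-- The real functional `X ↦ Tr[C X]` (real part) on Hermitian matrices. -/
def trFun {n : Type} [Fintype n] (C : Matrix n n ℂ) : Herm n →ₗ[ℝ] ℝ where
  toFun X := (C * (X : Matrix n n ℂ)).trace.re
  map_add' X Y := by simp [Matrix.mul_add]
  map_smul' r X := by simp

/-- A real scalar constraint `f x + c ≥ 0` as a matrix inequality `(f x + c) • I ≥ 0`. -/
def scalarLin {V : Type} [AddCommGroup V] [Module ℝ V] (n : Type) [DecidableEq n]
    (f : V →ₗ[ℝ] ℝ) : V →ₗ[ℝ] Matrix n n ℂ :=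
  f.smulRight (1 : Matrix n n ℂ)

theorem smul_one_isHermitian {n : Type} [DecidableEq n] (r : ℝ) :
    (r • (1 : Matrix n n ℂ)).IsHermitian := by
  unfold Matrix.IsHermitian
  rw [Matrix.conjTranspose_smul, Matrix.conjTranspose_one, star_trivial]

/-- The exponent `t`: `α/(α-1)` for `α < 1/2` and `1 - 1/α` for `α ≥ 1/2`. -/
def exponent (α : ℝ) : ℝ := if α < 1 / 2 then α / (α - 1) else 1 - 1 / α

/-- The objective: `α Tr[Ω Γ^N] + (1-α) Tr[Θ Γ^M]` for `α < 1/2`, and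
`α Tr[Θ Γ^N] + (1-α) Tr[Ω Γ^M]` for `α ≥ 1/2`. -/
def channelObj {A B : Type} [Fintype A] [Fintype B] (k : ℕ) (α : ℝ)
    (ΓN ΓM : Matrix (A × B) (A × B) ℂ) : ChannelVars A B k →ₗ[ℝ] ℝ :=
  let Ω : ChannelVars A B k →ₗ[ℝ] Herm (A × B) :=
    LinearMap.fst ℝ _ _ ∘ₗ LinearMap.snd ℝ _ _
  let Θ : ChannelVars A B k →ₗ[ℝ] Herm (A × B) :=
    LinearMap.fst ℝ _ _ ∘ₗ LinearMap.snd ℝ _ _ ∘ₗ LinearMap.snd ℝ _ _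
  if α < 1 / 2 then α • (trFun ΓN ∘ₗ Ω) + (1 - α) • (trFun ΓM ∘ₗ Θ)
  else α • (trFun ΓN ∘ₗ Θ) + (1 - α) • (trFun ΓM ∘ₗ Ω)

/-- The semidefinite program in the variables `(ρ, Ω, Θ, Z_1, …, Z_k)` with objective `channelObj`
and the matrix inequalities `L 1, …, L m` at `X = ρ ⊗ I`, `Y = Ω`, `T = Θ`, together with
`Tr[ρ] - 1 ≥ 0`, `1 - Tr[ρ] ≥ 0` and `E - Tr[Hᵀ ρ] ≥ 0` (times the identity matrix). -/
def channelSDP {A B : Type} [Fintype A] [DecidableEq A] [Fintype B] [DecidableEq B] {k m : ℕ}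
    (L : Fin m → BlockLMI k) (α : ℝ) (H : Matrix A A ℂ) (E : ℝ)
    (ΓN ΓM : Matrix (A × B) (A × B) ℂ) :
    SDP (ChannelVars A B k) (Fin 2 × (A × B)) (Fin m ⊕ Fin 3) where
  obj := channelObj k α ΓN ΓM
  const := Sum.elim (fun _ => 0) ![(-1 : ℝ) • 1, (1 : ℝ) • 1, E • 1]
  lin := Sum.elim (fun j => (L j).eval)
    ![scalarLin _ (trFun 1 ∘ₗ LinearMap.fst ℝ _ _),
      scalarLin _ (-(trFun 1 ∘ₗ LinearMap.fst ℝ _ _)),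
      scalarLin _ (-(trFun H.transpose ∘ₗ LinearMap.fst ℝ _ _))]
  const_isHermitian := by
    rintro (j | j)
    · exact Matrix.isHermitian_zero
    · fin_cases j <;> exact smul_one_isHermitian _
  lin_isHermitian := by
    rintro (j | j) x
    · exact (L j).eval_isHermitian x
    · fin_cases j <;> exact smul_one_isHermitian _

end

end MeasuredRenyi

/-! The first ingredient removes the reference system. A state `ρ` followed by effects `Λ x`
contracts to operators `X x ≥ 0` on `A × B` whose sum is the transposed input marginal tensored with
`1`, and outcome probabilities become traces of `X x` against Choi operators (`trace_mul_ampliate`);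
the transposed marginal is why `Hᵀ` appears. For positive definite inputs every such tester is
realized by a pure state (`exists_contract_eq`).

The second is scalar: `p ^ α * q ^ (1 - α)` is the infimum (`α < 1`) or supremum (`α > 1`) over `c >
0` of `α c^(1-α) p + (1-α) c^(-α) q`, by weighted AM-GM. Choosing one `c x` per outcome makes the
objective linear in the two operators `∑ c^(1-α) X` and `∑ c^(-α) X`. With `Ω = ∑ w X` one of them,
the other is `∑ w^t X`, where `t` is `exponent α`. Operator Jensen compares the latter with `G_t(ρ ⊗
I, Ω)` (`IsTester.wsum_le_geoMean`, `IsTester.geoMean_le_wsum`), and the spectral tester of `Ω`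
relative to `ρ ⊗ I` gives equality (`exists_isTester_geoMean`). This yields the variational
formulas. Singular inputs are reached by mixing with an interior input, the objective being linear
in the tester for fixed `c`.

For the programs, `T ≤ G_{k/2^l}(X, Y)` is a chain of `l` midpoint blocks. For a general denominator
`q` with `2^l ≤ q ≤ 2^(l+1)`, an extra variable `W` standing for `G_{2^l/q}(X, Y)` is characterized
implicitly: take `V ≤ G_{2-q/2^l}(X, W)` and require `[[V, W], [W, Y]] ≥ 0`, which forces
`G_{q/2^l}(X, W) ≤ Y`. Then `T ≤ G_{p/2^l}(X, W)` gives `T ≤ G_{p/q}(X, Y)` by monotonicity. Two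
chains of length `l` suffice, with coefficients independent of the matrix size.

All matrix arguments rest on one device: two positive definite matrices are simultaneously diagonal
in a congruence frame `S diag(·) Sᴴ`, where `G_t` acts on scalars. The chains also prove Jensen and
monotonicity for real `t`, by dyadic approximation. -/

set_option linter.unusedSectionVars false

namespace MeasuredRenyi

open Matrix
open scoped MatrixOrder

/-! ### Frames -/

section Frames

variable {n m : Type} [Fintype n] [DecidableEq n] [Fintype m] [DecidableEq m]

/-- The matrix `S diag(e) Sᴴ`. -/
noncomputable def frame (S : Matrix n m ℂ) (e : m → ℝ) : Matrix n n ℂ :=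
  S * diagonal (fun i => (e i : ℂ)) * Sᴴ

theorem diagonal_ofReal_posSemidef {e : m → ℝ} (he : ∀ i, 0 ≤ e i) :
    (diagonal (fun i => (e i : ℂ))).PosSemidef :=
  PosSemidef.diagonal fun i => by simpa using he i

theorem diagonal_ofReal_mul (e f : m → ℝ) :
    diagonal (fun i => (e i : ℂ)) * diagonal (fun i => (f i : ℂ)) =
      diagonal (fun i => ((e i * f i : ℝ) : ℂ)) := by
  simp [diagonal_mul_diagonal]

theorem diagonal_ofReal_conjTranspose (e : m → ℝ) :
    (diagonal (fun i => (e i : ℂ)))ᴴ = diagonal (fun i => (e i : ℂ)) := by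
  rw [diagonal_conjTranspose]
  congr 1
  ext i
  simp

theorem frame_posSemidef (S : Matrix n m ℂ) {e : m → ℝ} (he : ∀ i, 0 ≤ e i) :
    (frame S e).PosSemidef :=
  (diagonal_ofReal_posSemidef he).mul_mul_conjTranspose_same S

theorem frame_isHermitian (S : Matrix n m ℂ) (e : m → ℝ) : (frame S e).IsHermitian := by
  unfold frame IsHermitian
  rw [conjTranspose_mul, conjTranspose_mul, conjTranspose_conjTranspose,
    diagonal_ofReal_conjTranspose, Matrix.mul_assoc]

theorem frame_add (S : Matrix n m ℂ) (e f : m → ℝ) :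
    frame S e + frame S f = frame S (fun i => e i + f i) := by
  simp only [frame, ← Matrix.add_mul, ← Matrix.mul_add, diagonal_add]
  simp

theorem frame_posDef {S : Matrix n n ℂ} (hS : IsUnit S) {e : n → ℝ} (he : ∀ i, 0 < e i) :
    (frame S e).PosDef := by
  refine (IsUnit.posDef_star_right_conjugate_iff hS).2 ?_
  exact PosDef.diagonal fun i => by simpa using he i

theorem frame_mul_diagonal (S : Matrix n m ℂ) (c e : m → ℝ) :
    frame (S * diagonal (fun i => (c i : ℂ))) e = frame S (fun i => c i * e i * c i) := by
  simp only [frame, conjTranspose_mul, diagonal_ofReal_conjTranspose]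
  rw [← diagonal_ofReal_mul (fun i => c i * e i) c, ← diagonal_ofReal_mul]
  simp only [Matrix.mul_assoc]

theorem frame_eq_sum (S : Matrix n m ℂ) (e : m → ℝ) :
    frame S e = ∑ i, (e i : ℂ) • frame S (Pi.single i 1) := by
  have : diagonal (fun i => (e i : ℂ)) =
      ∑ i, (e i : ℂ) • diagonal (fun j => ((Pi.single i (1 : ℝ) : m → ℝ) j : ℂ)) := by
    ext j k
    rw [Matrix.sum_apply]
    by_cases h : j = k
    · subst h
      rw [Finset.sum_eq_single j]
      · simp
      · intro k _ hk
        simp [hk.symm]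
      · simp
    · simp [h]
  rw [frame, this]
  simp only [frame, Matrix.mul_sum, Matrix.sum_mul, Matrix.mul_smul, Matrix.smul_mul]

/-- Spectral powers of a positive definite matrix. -/
theorem mpow_eq {X : Matrix n n ℂ} (hX : X.IsHermitian) (t : ℝ) :
    mpow X t = frame (hX.eigenvectorUnitary : Matrix n n ℂ) (fun i => hX.eigenvalues i ^ t) := by
  rw [mpow, hX.cfc_eq, IsHermitian.cfc, Unitary.conjStarAlgAut_apply]
  rfl

theorem frame_unitary_mul (U : unitaryGroup n ℂ) (e f : n → ℝ) :
    frame (U : Matrix n n ℂ) e * frame (U : Matrix n n ℂ) f =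
      frame (U : Matrix n n ℂ) (fun i => e i * f i) := by
  have hU : (U : Matrix n n ℂ)ᴴ * (U : Matrix n n ℂ) = 1 := Unitary.coe_star_mul_self U
  simp only [frame, ← diagonal_ofReal_mul, Matrix.mul_assoc]
  rw [← Matrix.mul_assoc (U : Matrix n n ℂ)ᴴ, hU, Matrix.one_mul]

theorem frame_unitary_one (U : unitaryGroup n ℂ) :
    frame (U : Matrix n n ℂ) (fun _ => 1) = 1 := by
  have hU : (U : Matrix n n ℂ) * (U : Matrix n n ℂ)ᴴ = 1 := Unitary.coe_mul_star_self U
  simp [frame, hU]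

theorem eq_frame_eigenvalues {X : Matrix n n ℂ} (hX : X.IsHermitian) :
    X = frame (hX.eigenvectorUnitary : Matrix n n ℂ) hX.eigenvalues := by
  conv_lhs => rw [hX.spectral_theorem]
  rw [Unitary.conjStarAlgAut_apply]
  rfl

/-- Take `S = X^{1/2} V` with `V` a unitary diagonalizing `X^{-1/2} Y X^{-1/2}`. One frame serves
all exponents, so relations between geometric means of the same pair become scalar identities. -/
theorem exists_frame_geoMean {X Y : Matrix n n ℂ} (hX : X.PosDef) (hY : Y.PosDef) :
    ∃ (S : Matrix n n ℂ) (d : n → ℝ), IsUnit S ∧ (∀ i, 0 < d i) ∧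
      X = frame S (fun _ => 1) ∧ Y = frame S d ∧
      ∀ t, geoMean t X Y = frame S (fun i => d i ^ t) := by
  have hpos := hX.eigenvalues_pos
  set A := mpow X (1 / 2) with hA
  set B := mpow X (-(1 / 2)) with hB
  have hAh : A.IsHermitian := by rw [hA, mpow_eq hX.1]; exact frame_isHermitian _ _
  have hBh : B.IsHermitian := by rw [hB, mpow_eq hX.1]; exact frame_isHermitian _ _
  have hAA : A * A = X := by
    conv_rhs => rw [eq_frame_eigenvalues hX.1]
    rw [hA, mpow_eq hX.1, frame_unitary_mul]
    congr 1
    ext i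
    rw [← Real.rpow_add (hpos i)]
    norm_num
  have hAB : A * B = 1 := by
    rw [hA, hB, mpow_eq hX.1, mpow_eq hX.1, frame_unitary_mul, ← frame_unitary_one
      hX.1.eigenvectorUnitary]
    congr 1
    ext i
    rw [← Real.rpow_add (hpos i)]
    norm_num
  have hBA : B * A = 1 := mul_eq_one_comm.1 hAB
  have hBu : IsUnit B := IsUnit.of_mul_eq_one A hBA
  have hM : (B * Y * B).PosDef := by
    have := (IsUnit.posDef_star_right_conjugate_iff (x := Y) hBu).2 hY
    rwa [star_eq_conjTranspose, hBh.eq] at this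
  set V := (hM.1.eigenvectorUnitary : Matrix n n ℂ) with hV
  have hVV : V * Vᴴ = 1 := Unitary.coe_mul_star_self hM.1.eigenvectorUnitary
  have key : ∀ e, frame (A * V) e = A * frame V e * A := by
    intro e
    simp only [frame, conjTranspose_mul, hAh.eq, Matrix.mul_assoc]
  refine ⟨A * V, hM.1.eigenvalues, (IsUnit.of_mul_eq_one B hAB).mul
    (IsUnit.of_mul_eq_one _ hVV), hM.eigenvalues_pos, ?_, ?_, fun t => ?_⟩
  · rw [key, frame_unitary_one, Matrix.mul_one, hAA]
  · rw [key, ← eq_frame_eigenvalues hM.1]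
    simp only [← Matrix.mul_assoc]
    rw [hAB, Matrix.one_mul, Matrix.mul_assoc, hBA, Matrix.mul_one]
  · rw [key, geoMean, mpow_eq hM.1]

end Frames

/-! ### Two by two block inequalities -/

section Blocks

variable {n m : Type} [Fintype n] [DecidableEq n] [Fintype m] [DecidableEq m]

/-- The inequality `[[P, T], [T, Q]] ≥ 0`. -/
def Blk (P T Q : Matrix n n ℂ) : Prop := (fromBlocks P T T Q).PosSemidef

theorem Blk.isHermitian {P T Q : Matrix n n ℂ} (h : Blk P T Q) : T.IsHermitian :=
  (isHermitian_fromBlocks_iff.1 h.1).2.1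

theorem Blk.left {P T Q : Matrix n n ℂ} (h : Blk P T Q) : P.PosSemidef := by
  exact h.submatrix Sum.inl

theorem Blk.right {P T Q : Matrix n n ℂ} (h : Blk P T Q) : Q.PosSemidef := by
  exact h.submatrix Sum.inr

theorem Blk.symm {P T Q : Matrix n n ℂ} (h : Blk P T Q) : Blk Q T P := by
  have := h.submatrix (Sum.swap : n ⊕ n → n ⊕ n)
  rwa [fromBlocks_submatrix_sum_swap_sum_swap] at this

theorem Blk.add {P T Q P' T' Q' : Matrix n n ℂ} (h : Blk P T Q) (h' : Blk P' T' Q') :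
    Blk (P + P') (T + T') (Q + Q') := by
  have := PosSemidef.add h h'
  rwa [fromBlocks_add] at this

theorem blk_diag_iff {P Q : Matrix n n ℂ} : Blk P 0 Q ↔ P.PosSemidef ∧ Q.PosSemidef := by
  refine ⟨fun h => ⟨h.left, h.right⟩, fun ⟨hP, hQ⟩ => ?_⟩
  refine PosSemidef.of_dotProduct_mulVec_nonneg
    (hP.1.fromBlocks (by simp) hQ.1) fun x => ?_
  rw [fromBlocks_mulVec, dotProduct, Fintype.sum_sum_type]
  simp only [Pi.star_apply, Sum.elim_inl, Sum.elim_inr, zero_mulVec, add_zero, zero_add]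
  exact add_nonneg (hP.dotProduct_mulVec_nonneg (x ∘ Sum.inl))
    (hQ.dotProduct_mulVec_nonneg (x ∘ Sum.inr))

theorem Blk.mono {P T Q P' Q' : Matrix n n ℂ} (h : Blk P T Q) (hP : P ≤ P') (hQ : Q ≤ Q') :
    Blk P' T Q' := by
  have := h.add (blk_diag_iff.2 ⟨hP, hQ⟩)
  simpa using this

theorem Blk.conj {P T Q : Matrix n n ℂ} (h : Blk P T Q) (S : Matrix m n ℂ) :
    Blk (S * P * Sᴴ) (S * T * Sᴴ) (S * Q * Sᴴ) := by
  have := PosSemidef.mul_mul_conjTranspose_same h (fromBlocks S 0 0 S)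
  rw [fromBlocks_conjTranspose, fromBlocks_multiply, fromBlocks_multiply] at this
  simpa [Blk] using this

/-- Congruence reduces to diagonal matrices, where the Schur complement is `b - c² / a`. `S` may be
rectangular; this is what later admits dilations. -/
theorem blk_frame (S : Matrix n m ℂ) {a c b : m → ℝ} (ha : ∀ i, 0 < a i)
    (h : ∀ i, c i * c i ≤ a i * b i) : Blk (frame S a) (frame S c) (frame S b) := by
  refine Blk.conj (?_ : Blk _ _ _) S
  have hA : (diagonal (fun i => (a i : ℂ))).PosDef :=
    PosDef.diagonal fun i => by simpa using ha i
  have : Invertible (diagonal (fun i => (a i : ℂ))) := hA.isUnit.invertible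
  have hinv : (diagonal (fun i => (a i : ℂ)))⁻¹ = diagonal (fun i => ((a i)⁻¹ : ℝ) : m → ℂ) := by
    refine inv_eq_right_inv ?_
    rw [diagonal_ofReal_mul, ← diagonal_one]
    congr 1
    ext i
    simp [(ha i).ne']
  have key := (PosDef.fromBlocks₁₁ (diagonal (fun i => (c i : ℂ)))
    (diagonal (fun i => (b i : ℂ))) hA).2
  rw [diagonal_ofReal_conjTranspose, hinv, diagonal_ofReal_mul, diagonal_ofReal_mul,
    diagonal_sub] at key
  refine key ?_
  have := diagonal_ofReal_posSemidef (e := fun i => b i - c i * (a i)⁻¹ * c i) fun i => by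
    have := h i
    rw [sub_nonneg, mul_assoc, mul_comm, mul_assoc, inv_mul_le_iff₀ (ha i)]
    exact this
  simpa using this

/-- `[[D, T], [T, D⁻¹]] ≥ 0` implies `T ≤ 1`. -/
theorem Blk.le_one {D E T : Matrix n n ℂ} (hE : E.PosDef) (hED : E * D = 1) (h : Blk D T E) :
    T ≤ 1 := by
  have hT := h.isHermitian
  have hN : (1 - T).IsHermitian := isHermitian_one.sub hT
  rw [Matrix.le_iff, hN.posSemidef_iff_eigenvalues_nonneg]
  intro i
  set v : n → ℂ := ⇑(hN.eigenvectorBasis i) with hv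
  have hv0 : v ≠ 0 := by
    intro h0
    exact hN.eigenvectorBasis.orthonormal.ne_zero i (by ext j; exact congrFun h0 j)
  have hmv : (1 - T) *ᵥ v = (hN.eigenvalues i) • v := hN.mulVec_eigenvectorBasis i
  set μ := hN.eigenvalues i with hμ
  have hTv : T *ᵥ v = v - (μ : ℂ) • v := by
    have : (1 - T) *ᵥ v = (μ : ℂ) • v := hmv
    rw [← this, sub_mulVec, one_mulVec, sub_sub_cancel]
  have hDE : D * E = 1 := mul_eq_one_comm.1 hED
  have h3 := hE.dotProduct_mulVec_pos hv0
  -- With `T v = (1 - μ) v` and `E = D⁻¹`, the block form at `(-E v, v)` equals `2 μ ⟨v, E v⟩`, so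
  -- `μ ≥ 0`.
  have h2 := h.dotProduct_mulVec_nonneg (Sum.elim (-(E *ᵥ v)) v)
  have h4 : star (E *ᵥ v) ⬝ᵥ v = star v ⬝ᵥ E *ᵥ v := by
    rw [star_mulVec, hE.1.eq, dotProduct_mulVec]
  have h5 : star v ⬝ᵥ (T *ᵥ (E *ᵥ v)) = (1 - μ) * (star v ⬝ᵥ E *ᵥ v) := by
    rw [dotProduct_mulVec]
    nth_rewrite 1 [← hT.eq]
    rw [← star_mulVec, hTv]
    simp [sub_dotProduct, sub_mul]
  have h6 : star (Sum.elim (-(E *ᵥ v)) v) = Sum.elim (-star (E *ᵥ v)) (star v) := by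
    ext (j | j) <;> simp
  rw [fromBlocks_mulVec, h6, sumElim_dotProduct_sumElim] at h2
  have h7 : (Sum.elim (-(E *ᵥ v)) v) ∘ Sum.inl = -(E *ᵥ v) := rfl
  have h8 : (Sum.elim (-(E *ᵥ v)) v) ∘ Sum.inr = v := rfl
  rw [h7, h8, mulVec_neg, mulVec_neg, mulVec_mulVec v D E, hDE, one_mulVec, hTv, neg_dotProduct,
    dotProduct_add, dotProduct_add, dotProduct_sub, dotProduct_neg, dotProduct_neg, h5,
    dotProduct_smul, h4, smul_eq_mul] at h2
  have h9 : (0 : ℂ) ≤ (2 * μ : ℝ) * (star v ⬝ᵥ E *ᵥ v) := by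
    convert h2 using 1
    push_cast
    ring
  obtain ⟨r, hr, hr'⟩ := RCLike.pos_iff_exists_ofReal.1 h3
  rw [← hr'] at h9
  have h10 : 0 ≤ 2 * μ * r := by
    rw [← Complex.zero_le_real, Complex.ofReal_mul]
    exact h9
  have := nonneg_of_mul_nonneg_left h10 hr
  simpa using this

theorem frame_le_frame_iff {S : Matrix n n ℂ} (hS : IsUnit S) {X Y : Matrix n n ℂ} :
    S * X * Sᴴ ≤ S * Y * Sᴴ ↔ X ≤ Y := by
  rw [Matrix.le_iff, Matrix.le_iff, ← Matrix.sub_mul, ← Matrix.mul_sub]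
  exact IsUnit.posSemidef_star_right_conjugate_iff hS

/-- If `P = S diag(a) Sᴴ` and `Q = S diag(b) Sᴴ`, then `[[P, T], [T, Q]] ≥ 0` implies
`T ≤ S diag(c) Sᴴ` as soon as `c ^ 2 = a b`. -/
theorem Blk.le_frame {S T : Matrix n n ℂ} (hS : IsUnit S) {a b c : n → ℝ}
    (hb : ∀ i, 0 < b i) (hc : ∀ i, 0 < c i) (h : ∀ i, c i * c i = a i * b i)
    (hT : Blk (frame S a) T (frame S b)) : T ≤ frame S c := by
  -- Absorbing the square root of `c` into the frame turns `c` into `1` and makes `a / c` and `b /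
  -- c` reciprocal, the situation of `Blk.le_one`.
  set R := S * diagonal (fun i => ((c i) ^ (1 / 2 : ℝ) : ℝ) : n → ℂ) with hR
  have hs : ∀ i, c i ^ (1 / 2 : ℝ) * c i ^ (1 / 2 : ℝ) = c i := fun i => by
    rw [← Real.rpow_add (hc i)]
    norm_num
  have hs0 : ∀ i, 0 < c i ^ (1 / 2 : ℝ) := fun i => Real.rpow_pos_of_pos (hc i) _
  have hfr : ∀ e : n → ℝ, frame S e = frame R (fun i => e i / c i) := fun e => by
    rw [hR, frame_mul_diagonal]
    congr 1
    ext i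
    rw [mul_right_comm, hs, mul_div_cancel₀ _ (hc i).ne']
  have hRu : IsUnit R := by
    refine hS.mul ?_
    exact (PosDef.diagonal fun i => by simpa using hs0 i).isUnit
  obtain ⟨V, hV⟩ : ∃ V, R * V = 1 := by
    obtain ⟨u, hu⟩ := hRu
    exact ⟨(u⁻¹ : (Matrix n n ℂ)ˣ), by rw [← hu]; simp⟩
  have hV' : V * R = 1 := mul_eq_one_comm.1 hV
  have hVH : Rᴴ * Vᴴ = 1 := by rw [← conjTranspose_mul, hV', conjTranspose_one]
  have hVH' : Vᴴ * Rᴴ = 1 := mul_eq_one_comm.1 hVH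
  have hVf : ∀ e : n → ℝ, V * frame R e * Vᴴ = diagonal (fun i => (e i : ℂ)) := fun e => by
    simp only [frame, ← Matrix.mul_assoc]
    rw [hV', Matrix.one_mul, Matrix.mul_assoc, hVH, Matrix.mul_one]
  have hVT : R * (V * T * Vᴴ) * Rᴴ = T := by
    simp only [← Matrix.mul_assoc]
    rw [hV, Matrix.one_mul, Matrix.mul_assoc, hVH', Matrix.mul_one]
  rw [hfr a, hfr b] at hT
  have h1 := hT.conj V
  rw [hVf, hVf] at h1
  have h2 : V * T * Vᴴ ≤ 1 := by
    refine h1.le_one (PosDef.diagonal fun i => Complex.zero_lt_real.2 (div_pos (hb i) (hc i))) ?_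
    rw [diagonal_ofReal_mul, ← diagonal_one]
    congr 1
    ext i
    have : b i / c i * (a i / c i) = 1 := by
      rw [div_mul_div_comm, mul_comm (b i), ← h i, div_self (mul_pos (hc i) (hc i)).ne']
    rw [this]
    simp
  rw [hfr c, ← hVT]
  have h3 : frame R (fun i => c i / c i) = R * 1 * Rᴴ := by
    rw [frame]
    congr 2
    rw [← diagonal_one]
    congr 1
    ext i
    simp [(hc i).ne']
  rw [h3]
  exact (frame_le_frame_iff hRu).2 h2

/-- The Schur complement of `[[T, X], [X, Y]] ≥ 0` for `X = S diag(a) Sᴴ`, `Y = S diag(b) Sᴴ`. -/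
theorem Blk.frame_le {S T : Matrix n n ℂ} (hS : IsUnit S) {a b c : n → ℝ}
    (hb : ∀ i, 0 < b i) (h : ∀ i, a i * a i = c i * b i)
    (hT : Blk T (frame S a) (frame S b)) : frame S c ≤ T := by
  have hB := frame_posDef hS hb
  have : Invertible (frame S b) := hB.isUnit.invertible
  have key := (PosDef.fromBlocks₂₂ T (frame S a) hB).1
    (by rw [(frame_isHermitian S a).eq]; exact hT)
  rw [(frame_isHermitian S a).eq] at key
  suffices frame S a * (frame S b)⁻¹ * frame S a = frame S c by rwa [this] at key
  have hSd : IsUnit S.det := (isUnit_iff_isUnit_det S).1 hS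
  have hinv : (diagonal (fun i => (b i : ℂ)))⁻¹ = diagonal (fun i => ((b i)⁻¹ : ℝ) : n → ℂ) := by
    refine inv_eq_right_inv ?_
    rw [diagonal_ofReal_mul, ← diagonal_one]
    congr 1
    ext i
    simp [(hb i).ne']
  have hSH : IsUnit Sᴴ.det := by rw [det_conjTranspose]; exact hSd.star
  have hac : frame S c = S * (diagonal (fun i => (a i : ℂ)) * diagonal (fun i => ((b i)⁻¹ : ℝ) : n → ℂ)
      * diagonal (fun i => (a i : ℂ))) * Sᴴ := by
    rw [diagonal_ofReal_mul, diagonal_ofReal_mul, frame]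
    have : c = fun i => a i * (b i)⁻¹ * a i := by
      ext i
      have := hb i
      have := h i
      field_simp
      linarith
    rw [congrArg (fun c => S * diagonal (fun i => ((c i : ℝ) : ℂ)) * Sᴴ) this]
  rw [hac]
  simp only [frame, Matrix.mul_inv_rev, hinv]
  simp only [Matrix.mul_assoc]
  rw [mul_nonsing_inv_cancel_left _ _ hSH, nonsing_inv_mul_cancel_left _ _ hSd]

end Blocks

end MeasuredRenyi
namespace MeasuredRenyi

open Matrix Filter Topology
open scoped MatrixOrder

/-! ### Block inequalities for geometric means with dyadic exponents. -/

section Dyadic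

variable {n m : Type} [Fintype n] [DecidableEq n] [Fintype m] [DecidableEq m]

theorem posSemidef_of_tendsto {f : ℕ → Matrix n n ℂ} {M : Matrix n n ℂ}
    (h : Tendsto f atTop (𝓝 M)) (hf : ∀ k, (f k).PosSemidef) : M.PosSemidef := by
  refine PosSemidef.of_dotProduct_mulVec_nonneg ?_ fun x => ?_
  · have h1 : Tendsto (fun k => (f k)ᴴ) atTop (𝓝 Mᴴ) :=
      ((continuous_id.matrix_conjTranspose).tendsto M).comp h
    exact tendsto_nhds_unique h1 (h.congr fun k => (hf k).1.eq.symm)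
  · have hc : Continuous fun M : Matrix n n ℂ => star x ⬝ᵥ (M *ᵥ x) := by fun_prop
    exact ge_of_tendsto' ((hc.tendsto M).comp h) fun k => (hf k).dotProduct_mulVec_nonneg x

theorem continuous_frame (S : Matrix n m ℂ) : Continuous (frame S) := by
  unfold frame
  fun_prop

/-- `Dyadic l k X Y T` expresses `T ≤ G_{k / 2 ^ l}(X, Y)` by block inequalities. -/
def Dyadic : ℕ → ℕ → Matrix n n ℂ → Matrix n n ℂ → Matrix n n ℂ → Prop
  -- The first block forces `X, Y ≥ 0`. The difference is repeated on the diagonal only to fit the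
  -- common block format.
  | 0, k, X, Y, T => Blk X 0 Y ∧ Blk ((if k = 0 then X else Y) - T) 0 ((if k = 0 then X else Y) - T)
  | l + 1, k, X, Y, T =>
    -- The exponent `k / 2^(l+1)` is the midpoint of `0` and `k / 2^l`, or else of `(k - 2^l) / 2^l`
    -- and `1`. A block bounds `T` by the midpoint mean of its diagonal entries.
    if k ≤ 2 ^ l then ∃ Z : Matrix n n ℂ, Z.IsHermitian ∧ Dyadic l k X Y Z ∧ Blk X T Z
    else ∃ Z : Matrix n n ℂ, Z.IsHermitian ∧ Dyadic l (k - 2 ^ l) X Y Z ∧ Blk Z T Y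

theorem Dyadic.posSemidef {l k : ℕ} {X Y T : Matrix n n ℂ} (h : Dyadic l k X Y T) :
    X.PosSemidef ∧ Y.PosSemidef := by
  induction l generalizing k T with
  | zero => exact ⟨h.1.left, h.1.right⟩
  | succ l ih =>
    rw [Dyadic] at h
    split_ifs at h <;> obtain ⟨Z, _, h, _⟩ := h <;> exact ih h

/-- The inequalities are linear and homogeneous, so solutions form a convex cone. Adding a
nonsingular solution later removes degeneracies. -/
theorem Dyadic.add {l k : ℕ} {X Y T X' Y' T' : Matrix n n ℂ} (h : Dyadic l k X Y T)
    (h' : Dyadic l k X' Y' T') : Dyadic l k (X + X') (Y + Y') (T + T') := by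
  induction l generalizing k T T' with
  | zero =>
    obtain ⟨h1, h2⟩ := h
    obtain ⟨h1', h2'⟩ := h'
    refine ⟨by simpa using h1.add h1', ?_⟩
    have := h2.add h2'
    split_ifs at this ⊢ <;> rwa [add_zero, sub_add_sub_comm] at this
  | succ l ih =>
    rw [Dyadic] at h h' ⊢
    split_ifs at h h' ⊢ <;> obtain ⟨Z, hZ, h1, h2⟩ := h <;> obtain ⟨Z', hZ', h1', h2'⟩ := h' <;>
      exact ⟨Z + Z', hZ.add hZ', ih h1 h1', h2.add h2'⟩

theorem Dyadic.mono_right {l k : ℕ} {X Y T Y' : Matrix n n ℂ} (h : Dyadic l k X Y T)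
    (hY : Y ≤ Y') : Dyadic l k X Y' T := by
  induction l generalizing k T with
  | zero =>
    obtain ⟨h1, h2⟩ := h
    refine ⟨h1.mono le_rfl hY, ?_⟩
    split_ifs at h2 ⊢
    · exact h2
    · exact h2.mono (sub_le_sub_right hY T) (sub_le_sub_right hY T)
  | succ l ih =>
    rw [Dyadic] at h ⊢
    split_ifs at h ⊢ <;> obtain ⟨Z, hZ, h1, h2⟩ := h
    · exact ⟨Z, hZ, ih h1, h2⟩
    · exact ⟨Z, hZ, ih h1, h2.mono le_rfl hY⟩

/-- Weighted geometric mean of positive reals. -/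
noncomputable def gm (t a b : ℝ) : ℝ := a ^ (1 - t) * b ^ t

theorem gm_pos {a b : ℝ} (ha : 0 < a) (hb : 0 < b) (t : ℝ) : 0 < gm t a b :=
  mul_pos (Real.rpow_pos_of_pos ha _) (Real.rpow_pos_of_pos hb _)

theorem gm_zero (a b : ℝ) : gm 0 a b = a := by simp [gm]

theorem gm_one (a b : ℝ) : gm 1 a b = b := by simp [gm]

theorem gm_swap (t a b : ℝ) : gm t a b = gm (1 - t) b a := by
  simp [gm, mul_comm]

theorem gm_mul_gm {a b : ℝ} (ha : 0 < a) (hb : 0 < b) {s t u v : ℝ} (h : s + t = u + v) :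
    gm s a b * gm t a b = gm u a b * gm v a b := by
  unfold gm
  rw [mul_mul_mul_comm, mul_mul_mul_comm (a ^ (1 - u)), ← Real.rpow_add ha, ← Real.rpow_add ha,
    ← Real.rpow_add hb, ← Real.rpow_add hb, h]
  congr 2
  linarith

theorem gm_gm {a b : ℝ} (ha : 0 < a) (hb : 0 < b) (s t : ℝ) : gm s a (gm t a b) = gm (s * t) a b := by
  unfold gm
  rw [Real.mul_rpow (Real.rpow_nonneg ha.le _) (Real.rpow_nonneg hb.le _), ← Real.rpow_mul ha.le,
    ← Real.rpow_mul hb.le, ← mul_assoc, ← Real.rpow_add ha]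
  congr 2 <;> ring

/-- The means at the intermediate exponents serve as the variables `Z`; each midpoint block then
holds with equality `c² = a b` in every coordinate. No invertibility of `S` is needed. -/
theorem dyadic_frame (S : Matrix n m ℂ) {a b : m → ℝ} (ha : ∀ i, 0 < a i) (hb : ∀ i, 0 < b i)
    {l k : ℕ} (hk : k ≤ 2 ^ l) :
    Dyadic l k (frame S a) (frame S b) (frame S fun i => gm (k / 2 ^ l) (a i) (b i)) := by
  induction l generalizing k with
  | zero =>
    refine ⟨blk_diag_iff.2 ⟨frame_posSemidef _ fun i => (ha i).le,
      frame_posSemidef _ fun i => (hb i).le⟩, ?_⟩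
    have : k = 0 ∨ k = 1 := by simp at hk; omega
    rcases this with rfl | rfl
    · simp [gm_zero, blk_diag_iff, PosSemidef.zero]
    · simp [gm_one, blk_diag_iff, PosSemidef.zero]
  | succ l ih =>
    rw [Dyadic]
    split_ifs with hkl
    · refine ⟨_, frame_isHermitian _ _, ih hkl, blk_frame S ha fun i => le_of_eq ?_⟩
      conv_rhs => rw [← gm_zero (a i) (b i), gm_zero]
      rw [gm_mul_gm (ha i) (hb i) (u := 0) (v := k / 2 ^ l), gm_zero]
      rw [pow_succ]
      field_simp
      ring
    · have hk2 : k - 2 ^ l ≤ 2 ^ l := by rw [pow_succ] at hk; omega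
      refine ⟨_, frame_isHermitian _ _, ih hk2, blk_frame S (fun i => gm_pos (ha i) (hb i) _)
        fun i => le_of_eq ?_⟩
      rw [gm_mul_gm (ha i) (hb i) (u := ((k - 2 ^ l : ℕ) : ℝ) / 2 ^ l) (v := 1), gm_one]
      rw [Nat.cast_sub (by omega), pow_succ]
      push_cast
      field_simp
      ring

/-- Inductively `Z` may be enlarged to its upper bound, since it sits on the diagonal of a block;
all entries but `T` are then in the frame and `Blk.le_frame` applies. -/
theorem Dyadic.le_frame {S : Matrix n n ℂ} (hS : IsUnit S) {a b : n → ℝ} (ha : ∀ i, 0 < a i)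
    (hb : ∀ i, 0 < b i) {l k : ℕ} (hk : k ≤ 2 ^ l) {T : Matrix n n ℂ}
    (h : Dyadic l k (frame S a) (frame S b) T) :
    T ≤ frame S fun i => gm (k / 2 ^ l) (a i) (b i) := by
  induction l generalizing k T with
  | zero =>
    have : k = 0 ∨ k = 1 := by simp at hk; omega
    rcases this with rfl | rfl
    · simpa [gm_zero, Matrix.le_iff] using h.2.left
    · simpa [gm_one, Matrix.le_iff] using h.2.left
  | succ l ih =>
    rw [Dyadic] at h
    split_ifs at h with hkl
    · obtain ⟨Z, hZ, h1, h2⟩ := h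
      refine (h2.mono le_rfl (ih hkl h1)).le_frame hS (fun i => gm_pos (ha i) (hb i) _)
        (fun i => gm_pos (ha i) (hb i) _) fun i => ?_
      rw [gm_mul_gm (ha i) (hb i) (u := 0) (v := k / 2 ^ l), gm_zero]
      rw [pow_succ]
      field_simp
      ring
    · have hk2 : k - 2 ^ l ≤ 2 ^ l := by rw [pow_succ] at hk; omega
      obtain ⟨Z, hZ, h1, h2⟩ := h
      refine (h2.mono (ih hk2 h1) le_rfl).le_frame hS hb
        (fun i => gm_pos (ha i) (hb i) _) fun i => ?_
      rw [gm_mul_gm (ha i) (hb i) (u := ((k - 2 ^ l : ℕ) : ℝ) / 2 ^ l) (v := 1), gm_one]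
      rw [Nat.cast_sub (by omega), pow_succ]
      push_cast
      field_simp
      ring

theorem exists_dyadic_tendsto {t : ℝ} (h0 : 0 ≤ t) (h1 : t ≤ 1) :
    ∃ k : ℕ → ℕ, (∀ l, k l ≤ 2 ^ l) ∧ Tendsto (fun l => (k l : ℝ) / 2 ^ l) atTop (𝓝 t) := by
  refine ⟨fun l => ⌊t * 2 ^ l⌋₊, fun l => ?_, ?_⟩
  · refine Nat.floor_le_of_le ?_
    push_cast
    exact mul_le_of_le_one_left (by positivity) h1
  · exact (tendsto_nat_floor_mul_div_atTop h0).comp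
      (tendsto_pow_atTop_atTop_of_one_lt (one_lt_two : (1 : ℝ) < 2))

/-- Operator Jensen inequality and monotonicity for weighted geometric means with exponent in
`[0, 1]`. -/
theorem frame_gm_le {S : Matrix n n ℂ} (hS : IsUnit S) {a b : n → ℝ} (ha : ∀ i, 0 < a i)
    (hb : ∀ i, 0 < b i) (R : Matrix n m ℂ) {a' b' : m → ℝ} (ha' : ∀ i, 0 < a' i)
    (hb' : ∀ i, 0 < b' i) (h1 : frame R a' = frame S a) (h2 : frame R b' ≤ frame S b)
    {t : ℝ} (ht0 : 0 ≤ t) (ht1 : t ≤ 1) :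
    frame R (fun i => gm t (a' i) (b' i)) ≤ frame S fun i => gm t (a i) (b i) := by
  obtain ⟨k, hk, hkt⟩ := exists_dyadic_tendsto ht0 ht1
  have hgm : ∀ {x y : ℝ}, 0 < x → 0 < y →
      Tendsto (fun l => gm ((k l : ℝ) / 2 ^ l) x y) atTop (𝓝 (gm t x y)) := by
    intro x y hx hy
    have : Continuous fun t => gm t x y := by
      unfold gm
      exact ((Real.continuous_const_rpow hx.ne').comp (by fun_prop)).mul
        (Real.continuous_const_rpow hy.ne')
    exact (this.tendsto t).comp hkt
  have hR : Tendsto (fun l => frame R fun i => gm ((k l : ℝ) / 2 ^ l) (a' i) (b' i)) atTop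
      (𝓝 (frame R fun i => gm t (a' i) (b' i))) :=
    ((continuous_frame R).tendsto _).comp (tendsto_pi_nhds.2 fun i => hgm (ha' i) (hb' i))
  have hSt : Tendsto (fun l => frame S fun i => gm ((k l : ℝ) / 2 ^ l) (a i) (b i)) atTop
      (𝓝 (frame S fun i => gm t (a i) (b i))) :=
    ((continuous_frame S).tendsto _).comp (tendsto_pi_nhds.2 fun i => hgm (ha i) (hb i))
  refine posSemidef_of_tendsto (hSt.sub hR) fun l => ?_
  -- The rectangular frame solves the system for `frame R a'` and `frame R b'`. Replacing these by
  -- `frame S a` and the larger `frame S b`, and bounding in the invertible frame, yields Jensen and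
  -- monotonicity at once.
  have := dyadic_frame R ha' hb' (hk l)
  rw [h1] at this
  exact (this.mono_right h2).le_frame hS ha hb (hk l)

/-- The counterpart of `frame_gm_le` for exponents in `[-1, 0]`. -/
theorem frame_gm_neg_le {S : Matrix n n ℂ} (hS : IsUnit S) {a b : n → ℝ} (ha : ∀ i, 0 < a i)
    (hb : ∀ i, 0 < b i) (R : Matrix n m ℂ) {a' b' : m → ℝ} (ha' : ∀ i, 0 < a' i)
    (hb' : ∀ i, 0 < b' i) (h1 : frame R a' = frame S a) (h2 : frame R b' ≤ frame S b)
    {t : ℝ} (ht0 : 0 ≤ t) (ht1 : t ≤ 1) :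
    frame S (fun i => gm (-t) (a i) (b i)) ≤ frame R fun i => gm (-t) (a' i) (b' i) := by
  have h := frame_gm_le hS ha hb R ha' hb' h1 h2 ht0 ht1
  -- Since `G_{-t} G_t = X²` coordinatewise, `[[G_{-t}, X], [X, G_t]] ≥ 0` in the frame `R`.
  -- Enlarging `G_t` by the previous bound and taking the Schur complement in `S` reverses the
  -- inequality.
  have hblk := blk_frame R (fun i => gm_pos (ha' i) (hb' i) (-t)) (c := a')
    (b := fun i => gm t (a' i) (b' i)) fun i => le_of_eq ?_
  · rw [h1] at hblk
    refine (hblk.mono le_rfl h).frame_le hS (fun i => gm_pos (ha i) (hb i) _) fun i => ?_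
    rw [gm_mul_gm (ha i) (hb i) (u := 0) (v := 0) (by ring), gm_zero]
  · rw [gm_mul_gm (ha' i) (hb' i) (u := 0) (v := 0) (by ring), gm_zero]

/-! ### Rational exponents -/

/-- An implicit system for `W ≤ G_{2 ^ l / (2 ^ (l + 1) - k)}(X, Y)` and
`T ≤ G_{p / 2 ^ l}(X, W)`. -/
def RatGeo (l k p : ℕ) (X Y T : Matrix n n ℂ) : Prop :=
  ∃ W : Matrix n n ℂ, W.IsHermitian ∧ ∃ V : Matrix n n ℂ, V.IsHermitian ∧
    Dyadic l k X W V ∧ Blk V W Y ∧ Dyadic l p X W T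

theorem RatGeo.add {l k p : ℕ} {X Y T X' Y' T' : Matrix n n ℂ} (h : RatGeo l k p X Y T)
    (h' : RatGeo l k p X' Y' T') : RatGeo l k p (X + X') (Y + Y') (T + T') := by
  obtain ⟨W, hW, V, hV, h1, h2, h3⟩ := h
  obtain ⟨W', hW', V', hV', h1', h2', h3'⟩ := h'
  exact ⟨W + W', hW.add hW', V + V', hV.add hV', h1.add h1', h2.add h2', h3.add h3'⟩

theorem RatGeo.posSemidef {l k p : ℕ} {X Y T : Matrix n n ℂ} (h : RatGeo l k p X Y T) :
    X.PosSemidef ∧ Y.PosSemidef := by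
  obtain ⟨W, hW, V, hV, h1, h2, h3⟩ := h
  exact ⟨h1.posSemidef.1, h2.right⟩

/-- The bounds on `q` put `k = 2^(l+1) - q` in `[0, 2^l]`, with `k / 2^l = 2 - q / 2^l`. For `W =
G_{2^l/q}(X, Y)` and `V = G_{2-q/2^l}(X, W)` the exponents match so that `W² = V Y` coordinatewise.
-/
theorem ratGeo_witness (S : Matrix n m ℂ) {a b : m → ℝ} (ha : ∀ i, 0 < a i) (hb : ∀ i, 0 < b i)
    {l p q : ℕ} (hq : 2 ^ l ≤ q) (hq' : q ≤ 2 ^ (l + 1)) (hp : p ≤ 2 ^ l) :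
    Dyadic l (2 ^ (l + 1) - q) (frame S a) (frame S fun i => gm (2 ^ l / q) (a i) (b i))
        (frame S fun i => gm (2 - q / 2 ^ l) (a i) (gm (2 ^ l / q) (a i) (b i))) ∧
      Blk (frame S fun i => gm (2 - q / 2 ^ l) (a i) (gm (2 ^ l / q) (a i) (b i)))
        (frame S fun i => gm (2 ^ l / q) (a i) (b i)) (frame S b) ∧
      Dyadic l p (frame S a) (frame S fun i => gm (2 ^ l / q) (a i) (b i))
        (frame S fun i => gm (p / q) (a i) (b i)) := by
  have hk : 2 ^ (l + 1) - q ≤ 2 ^ l := by rw [pow_succ]; omega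
  have hq0 : (0 : ℝ) < q := by
    have : 0 < q := lt_of_lt_of_le (by positivity) hq
    exact_mod_cast this
  have hw : ∀ i, 0 < gm (2 ^ l / q) (a i) (b i) := fun i => gm_pos (ha i) (hb i) _
  have hkq : (((2 ^ (l + 1) - q : ℕ) : ℝ)) / 2 ^ l = 2 - q / 2 ^ l := by
    rw [Nat.cast_sub hq', pow_succ]
    push_cast
    field_simp
  refine ⟨?_, ?_, ?_⟩
  · have := dyadic_frame S ha hw hk
    rwa [hkq] at this
  · refine blk_frame S (fun i => gm_pos (ha i) (hw i) _) fun i => le_of_eq ?_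
    rw [gm_gm (ha i) (hb i), gm_mul_gm (ha i) (hb i) (u := (2 - q / 2 ^ l) * (2 ^ l / q)) (v := 1),
      gm_one]
    field_simp
    ring
  · have := dyadic_frame S ha hw hp
    simp only [gm_gm (ha _) (hb _)] at this
    convert this using 4
    field_simp

theorem ratGeo_frame (S : Matrix n m ℂ) {a b : m → ℝ} (ha : ∀ i, 0 < a i) (hb : ∀ i, 0 < b i)
    {l p q : ℕ} (hq : 2 ^ l ≤ q) (hq' : q ≤ 2 ^ (l + 1)) (hp : p ≤ 2 ^ l) :
    RatGeo l (2 ^ (l + 1) - q) p (frame S a) (frame S b)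
      (frame S fun i => gm (p / q) (a i) (b i)) :=
  ⟨_, frame_isHermitian _ _, _, frame_isHermitian _ _, ratGeo_witness S ha hb hq hq' hp⟩

/-- In a frame `R` for `X` and `W = R diag(e) Rᴴ`, the Schur complement gives `R diag(e^(q/2^l)) Rᴴ
≤ Y`, while `T ≤ R diag(e^(p/2^l)) Rᴴ`. The latter is the `p/q` mean of `X` and the former, and that
mean is monotone because `p/q ≤ 1`. -/
theorem ratGeo_le_of_posDef {S : Matrix n n ℂ} (hS : IsUnit S) {a b : n → ℝ} (ha : ∀ i, 0 < a i)
    (hb : ∀ i, 0 < b i) {l p q : ℕ} (hq : 2 ^ l ≤ q) (hq' : q ≤ 2 ^ (l + 1)) (hp : p ≤ 2 ^ l)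
    {W V T : Matrix n n ℂ} (hW : W.PosDef) (h1 : Dyadic l (2 ^ (l + 1) - q) (frame S a) W V)
    (h2 : Blk V W (frame S b)) (h3 : Dyadic l p (frame S a) W T) :
    T ≤ frame S fun i => gm (p / q) (a i) (b i) := by
  obtain ⟨R, e, hR, he, hXR, hWR, -⟩ := exists_frame_geoMean (frame_posDef hS ha) hW
  have hk : 2 ^ (l + 1) - q ≤ 2 ^ l := by rw [pow_succ]; omega
  have hq0 : (0 : ℝ) < q := by
    have : 0 < q := lt_of_lt_of_le (by positivity) hq
    exact_mod_cast this
  have hkq : (((2 ^ (l + 1) - q : ℕ) : ℝ)) / 2 ^ l = 2 - q / 2 ^ l := by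
    rw [Nat.cast_sub hq', pow_succ]
    push_cast
    field_simp
  have h1' := h1
  rw [hXR, hWR] at h1 h3
  have hV := h1.le_frame hR (fun _ => one_pos) he hk
  rw [hkq] at hV
  have hT := h3.le_frame hR (fun _ => one_pos) he hp
  have hY := (h2.mono hV le_rfl).symm
  rw [hWR] at hY
  have hY' := hY.frame_le hR (c := fun i => e i ^ (q / 2 ^ l : ℝ))
    (fun i => gm_pos one_pos (he i) _) fun i => by
      simp only [gm, Real.one_rpow, one_mul]
      rw [← Real.rpow_add (he i), add_sub_cancel, Real.rpow_two, sq]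
  refine hT.trans ?_
  have := frame_gm_le hS ha hb R (fun _ => one_pos) (fun i => Real.rpow_pos_of_pos (he i) _)
    hXR.symm hY' (t := p / q) (by positivity) ?_
  · convert this using 3 with i
    simp only [gm, Real.one_rpow, one_mul]
    rw [← Real.rpow_mul (he i).le]
    congr 1
    field_simp
  · rw [div_le_one hq0]
    exact_mod_cast hp.trans hq

/-- A solution may have singular `W`. Adding the canonical solution, with value `G`, makes `W`
positive definite and gives `T + G ≤ G(2X, 2Y) = 2G`; no limit is needed. -/
theorem RatGeo.le_frame {S : Matrix n n ℂ} (hS : IsUnit S) {a b : n → ℝ} (ha : ∀ i, 0 < a i)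
    (hb : ∀ i, 0 < b i) {l p q : ℕ} (hq : 2 ^ l ≤ q) (hq' : q ≤ 2 ^ (l + 1)) (hp : p ≤ 2 ^ l)
    {T : Matrix n n ℂ} (h : RatGeo l (2 ^ (l + 1) - q) p (frame S a) (frame S b) T) :
    T ≤ frame S fun i => gm (p / q) (a i) (b i) := by
  obtain ⟨W, hW, V, hV, h1, h2, h3⟩ := h
  obtain ⟨h1', h2', h3'⟩ := ratGeo_witness S ha hb hq hq' hp
  have h1s := h1.add h1'
  have h2s := h2.add h2'
  have h3s := h3.add h3'
  rw [frame_add] at h1s h2s h3s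
  have := ratGeo_le_of_posDef hS (fun i => add_pos (ha i) (ha i)) (fun i => add_pos (hb i) (hb i))
    hq hq' hp (PosDef.posSemidef_add h1.posSemidef.2
      (frame_posDef hS fun i => gm_pos (ha i) (hb i) _)) h1s h2s h3s
  have hadd : ∀ i, gm (p / q) (a i + a i) (b i + b i) =
      gm (p / q) (a i) (b i) + gm (p / q) (a i) (b i) := fun i => by
    simp only [gm, ← two_mul]
    rw [Real.mul_rpow two_pos.le (ha i).le, Real.mul_rpow two_pos.le (hb i).le, mul_mul_mul_comm,
      ← Real.rpow_add two_pos]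
    norm_num
  simp only [hadd] at this
  rw [← frame_add] at this
  exact le_of_add_le_add_right this

/-- Block inequalities for `T ≤ G_{p / q}(X, Y)`, where `p ≤ q`. -/
def Geo (p q : ℕ) (X Y T : Matrix n n ℂ) : Prop :=
  -- As `q < 2 * 2^l` for `l = Nat.log 2 q`, one of `p` and `q - p` is at most `2^l`; the symmetry
  -- `G_t(X, Y) = G_{1-t}(Y, X)` covers the second case.
  if p ≤ 2 ^ Nat.log 2 q then RatGeo (Nat.log 2 q) (2 ^ (Nat.log 2 q + 1) - q) p X Y T
  else RatGeo (Nat.log 2 q) (2 ^ (Nat.log 2 q + 1) - q) (q - p) Y X T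

theorem Geo.posSemidef {p q : ℕ} {X Y T : Matrix n n ℂ} (h : Geo p q X Y T) :
    X.PosSemidef ∧ Y.PosSemidef := by
  unfold Geo at h
  split_ifs at h
  · exact RatGeo.posSemidef h
  · exact (RatGeo.posSemidef h).symm

theorem log_bounds {q : ℕ} (hq : 0 < q) : 2 ^ Nat.log 2 q ≤ q ∧ q ≤ 2 ^ (Nat.log 2 q + 1) :=
  ⟨Nat.pow_log_le_self 2 hq.ne', (Nat.lt_pow_succ_log_self one_lt_two q).le⟩

theorem swap_exponent {p q : ℕ} (hq : 0 < q) (hpq : p ≤ q) (a b : ℝ) :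
    gm (((q - p : ℕ) : ℝ) / q) b a = gm (p / q) a b := by
  rw [gm_swap (p / q : ℝ)]
  congr 1
  have : (0 : ℝ) < q := by exact_mod_cast hq
  rw [Nat.cast_sub hpq]
  field_simp

theorem geo_frame (S : Matrix n m ℂ) {a b : m → ℝ} (ha : ∀ i, 0 < a i) (hb : ∀ i, 0 < b i)
    {p q : ℕ} (hq : 0 < q) (hpq : p ≤ q) :
    Geo p q (frame S a) (frame S b) (frame S fun i => gm (p / q) (a i) (b i)) := by
  obtain ⟨h1, h2⟩ := log_bounds hq
  unfold Geo
  split_ifs with h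
  · exact ratGeo_frame S ha hb h1 h2 h
  · have hqp : q - p ≤ 2 ^ Nat.log 2 q := by rw [pow_succ] at h2; omega
    simp only [← swap_exponent hq hpq]
    exact ratGeo_frame S hb ha h1 h2 hqp

theorem Geo.le_frame {S : Matrix n n ℂ} (hS : IsUnit S) {a b : n → ℝ} (ha : ∀ i, 0 < a i)
    (hb : ∀ i, 0 < b i) {p q : ℕ} (hq : 0 < q) (hpq : p ≤ q) {T : Matrix n n ℂ}
    (h : Geo p q (frame S a) (frame S b) T) : T ≤ frame S fun i => gm (p / q) (a i) (b i) := by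
  obtain ⟨h1, h2⟩ := log_bounds hq
  unfold Geo at h
  split_ifs at h with hp
  · exact h.le_frame hS ha hb h1 h2 hp
  · have hqp : q - p ≤ 2 ^ Nat.log 2 q := by rw [pow_succ] at h2; omega
    simp only [← swap_exponent hq hpq]
    exact h.le_frame hS hb ha h1 h2 hqp

/-- Block inequalities for the hypograph of `G_{p / q}`. -/
def Hyp (p q : ℕ) (X Y T : Matrix n n ℂ) : Prop :=
  -- The slack `Z` makes the relation closed downwards in `T`: a block with off-diagonal `T` also
  -- bounds `-T`.
  ∃ Z : Matrix n n ℂ, Z.IsHermitian ∧ Geo p q X Y Z ∧ Blk (Z - T) 0 (Z - T)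

/-- Block inequalities for the epigraph of `G_{-p / q}`. -/
def Epi (p q : ℕ) (X Y T : Matrix n n ℂ) : Prop :=
  ∃ Z : Matrix n n ℂ, Z.IsHermitian ∧ Geo p q X Y Z ∧ Blk T X Z

theorem hyp_iff {X Y T : Matrix n n ℂ} (hX : X.PosDef) (hY : Y.PosDef) {p q : ℕ} (hq : 0 < q)
    (hpq : p ≤ q) : Hyp p q X Y T ↔ T ≤ geoMean (p / q) X Y := by
  obtain ⟨S, d, hS, hd, rfl, rfl, hG⟩ := exists_frame_geoMean hX hY
  have hgm : geoMean (p / q) (frame S fun _ => 1) (frame S d) =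
      frame S fun i => gm (p / q) 1 (d i) := by
    rw [hG]
    simp [gm]
  rw [hgm]
  constructor
  · rintro ⟨Z, -, h1, h2⟩
    exact le_trans (h2.left : T ≤ Z) (h1.le_frame hS (fun _ => one_pos) hd hq hpq)
  · intro h
    exact ⟨_, frame_isHermitian _ _, geo_frame S (fun _ => one_pos) hd hq hpq,
      blk_diag_iff.2 ⟨h, h⟩⟩

/-- Because `G_{-t} = X G_t⁻¹ X`, the epigraph is a Schur complement over the hypograph variable
`Z`, which may be raised to `G_t`. -/
theorem epi_iff {X Y T : Matrix n n ℂ} (hX : X.PosDef) (hY : Y.PosDef) {p q : ℕ} (hq : 0 < q)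
    (hpq : p ≤ q) : Epi p q X Y T ↔ geoMean (-(p / q)) X Y ≤ T := by
  obtain ⟨S, d, hS, hd, rfl, rfl, hG⟩ := exists_frame_geoMean hX hY
  have hgm : geoMean (-(p / q)) (frame S fun _ => 1) (frame S d) =
      frame S fun i => gm (-(p / q)) 1 (d i) := by
    rw [hG]
    simp [gm]
  have h1 : ∀ i, (1 : ℝ) * 1 = gm (-(p / q)) 1 (d i) * gm (p / q) 1 (d i) := fun i => by
    rw [gm_mul_gm one_pos (hd i) (u := 0) (v := 0) (by ring), gm_zero]
  rw [hgm]
  constructor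
  · rintro ⟨Z, -, h2, h3⟩
    exact (h3.mono le_rfl (h2.le_frame hS (fun _ => one_pos) hd hq hpq)).frame_le hS
      (fun i => gm_pos one_pos (hd i) _) h1
  · intro h
    exact ⟨_, frame_isHermitian _ _, geo_frame S (fun _ => one_pos) hd hq hpq,
      (blk_frame S (fun i => gm_pos one_pos (hd i) _) fun i => (h1 i).le).mono h le_rfl⟩

end Dyadic

end MeasuredRenyi
namespace MeasuredRenyi

open Matrix
open scoped MatrixOrder

/-! ### Relations represented by block matrix inequalities with integer coefficients -/

section Representability

variable {ι : Type} [Fintype ι]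

/-- A relation between Hermitian matrices (of any size), indexed by `ι`, that is the projection of
the solution set of `m` linear matrix inequalities in `2 × 2` block form. -/
def LMIRep (ι : Type) [Fintype ι] (m : ℕ)
    (R : ∀ (n : Type) [Fintype n] [DecidableEq n], (ι → Matrix n n ℂ) → Prop) : Prop :=
  ∃ (κ : Type) (_ : Fintype κ) (c : Fin m → ι ⊕ κ → Matrix (Fin 2) (Fin 2) ℤ),
    (∀ j i, (c j i).IsSymm) ∧
    ∀ (n : Type) [Fintype n] [DecidableEq n] (v : ι → Matrix n n ℂ), (∀ i, (v i).IsHermitian) →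
      (R n v ↔ ∃ Z : κ → Matrix n n ℂ, (∀ i, (Z i).IsHermitian) ∧
        ∀ j, (∑ i, toC (c j i) ⊗ₖ Sum.elim v Z i).PosSemidef)

variable {R R' : ∀ (n : Type) [Fintype n] [DecidableEq n], (ι → Matrix n n ℂ) → Prop}

theorem LMIRep.congr {m : ℕ} (h : LMIRep ι m R)
    (hR : ∀ (n : Type) [Fintype n] [DecidableEq n] (v : ι → Matrix n n ℂ), R n v ↔ R' n v) :
    LMIRep ι m R' := by
  obtain ⟨κ, _, c, hc, h⟩ := h
  exact ⟨κ, _, c, hc, fun n _ _ v hv => (hR n v).symm.trans (h n v hv)⟩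

theorem toC_zero : toC 0 = 0 := by
  ext i j
  simp [toC]

/-- The auxiliary variables are kept disjoint, with zero coefficients across, so only the numbers of
inequalities add. -/
theorem LMIRep.and {m₁ m₂ : ℕ} (h₁ : LMIRep ι m₁ R) (h₂ : LMIRep ι m₂ R') :
    LMIRep ι (m₁ + m₂) (fun n _ _ v => R n v ∧ R' n v) := by
  obtain ⟨κ₁, _, c₁, hc₁, h₁⟩ := h₁
  obtain ⟨κ₂, _, c₂, hc₂, h₂⟩ := h₂
  refine ⟨κ₁ ⊕ κ₂, inferInstance, Fin.append
    (fun j => Sum.elim (fun i => c₁ j (.inl i)) (Sum.elim (fun k => c₁ j (.inr k)) fun _ => 0))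
    (fun j => Sum.elim (fun i => c₂ j (.inl i)) (Sum.elim (fun _ => 0) fun k => c₂ j (.inr k))),
    ?_, ?_⟩
  · intro j
    refine Fin.addCases (fun j => ?_) (fun j => ?_) j <;> rintro (i | i | i) <;>
      simp [IsSymm]
    · exact hc₁ j _
    · exact hc₁ j _
    · exact hc₂ j _
    · exact hc₂ j _
  · intro n _ _ v hv
    change (R n v ∧ R' n v) ↔ _
    rw [h₁ n v hv, h₂ n v hv]
    simp only [Fin.forall_fin_add, Fin.append_left, Fin.append_right, Fintype.sum_sum_type,
      Sum.elim_inl, Sum.elim_inr, toC_zero, zero_kronecker, Finset.sum_const_zero, add_zero,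
      zero_add]
    constructor
    · rintro ⟨⟨Z₁, hZ₁, h1⟩, ⟨Z₂, hZ₂, h2⟩⟩
      exact ⟨Sum.elim Z₁ Z₂, by rintro (i | i); exacts [hZ₁ i, hZ₂ i], by simpa using h1,
        by simpa using h2⟩
    · rintro ⟨Z, hZ, h1, h2⟩
      exact ⟨⟨fun i => Z (.inl i), fun i => hZ _, h1⟩, ⟨fun i => Z (.inr i), fun i => hZ _, h2⟩⟩

/-- The bound variable joins the auxiliary ones, so quantifiers cost no inequalities. -/
theorem LMIRep.exists {m : ℕ}
    {R : ∀ (n : Type) [Fintype n] [DecidableEq n], (Option ι → Matrix n n ℂ) → Prop}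
    (h : LMIRep (Option ι) m R) :
    LMIRep ι m (fun n _ _ v => ∃ Z : Matrix n n ℂ, Z.IsHermitian ∧ R n fun o => o.elim Z v) := by
  obtain ⟨κ, _, c, hc, h⟩ := h
  refine ⟨Option κ, inferInstance, fun j => Sum.elim (fun i => c j (.inl (some i)))
    (fun k => k.elim (c j (.inl none)) fun k => c j (.inr k)), ?_, ?_⟩
  · rintro j (i | _ | i) <;> exact hc j _
  · intro n _ _ v hv
    have key : ∀ (Z : Matrix n n ℂ) (Y : κ → Matrix n n ℂ) j,
        ∑ i, toC (Sum.elim (fun i => c j (.inl (some i)))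
          (fun k => Option.elim k (c j (.inl none)) fun k => c j (.inr k)) i) ⊗ₖ
            Sum.elim v (fun o => Option.elim o Z Y) i =
        ∑ i, toC (c j i) ⊗ₖ Sum.elim (fun o : Option ι => Option.elim o Z v) Y i := by
      intro Z Y j
      simp only [Fintype.sum_sum_type, Fintype.sum_option, Sum.elim_inl, Sum.elim_inr,
        Option.elim_none, Option.elim_some]
      abel
    constructor
    · rintro ⟨Z, hZ, hR⟩
      obtain ⟨Y, hY, hj⟩ := (h n _ (by rintro (_ | i); exacts [hZ, hv i])).1 hR
      exact ⟨fun o => o.elim Z Y, by rintro (_ | i); exacts [hZ, hY i],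
        fun j => by rw [key]; exact hj j⟩
    · rintro ⟨Y, hY, hj⟩
      refine ⟨Y none, hY none, (h n _ (by rintro (_ | i); exacts [hY none, hv i])).2
        ⟨fun k => Y (some k), fun k => hY _, fun j => ?_⟩⟩
      have hY' : (fun o : Option κ => o.elim (Y none) fun k => Y (some k)) = Y := by
        funext o
        cases o <;> rfl
      rw [← key, hY']
      exact hj j

/-- Integer linear combination of matrices. -/
noncomputable def intComb {n : Type} (p : ι → ℤ) (v : ι → Matrix n n ℂ) : Matrix n n ℂ :=
  ∑ i, (p i : ℂ) • v i

theorem intComb_single {n : Type} [DecidableEq ι] (a : ι) (v : ι → Matrix n n ℂ) :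
    intComb (Pi.single a 1) v = v a := by
  rw [intComb, Finset.sum_eq_single a]
  · simp
  · intro b _ hb
    simp [hb]
  · simp

theorem intComb_sub {n : Type} (p q : ι → ℤ) (v : ι → Matrix n n ℂ) :
    intComb (p - q) v = intComb p v - intComb q v := by
  simp [intComb, sub_smul]

theorem intComb_zero {n : Type} (v : ι → Matrix n n ℂ) : intComb 0 v = 0 := by
  simp [intComb]

/-- The reindexing between the two forms of two by two block matrices. -/
def finTwoProdEquiv (n : Type) : n ⊕ n ≃ Fin 2 × n where
  toFun := Sum.elim (fun i => (0, i)) (fun i => (1, i))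
  invFun x := if x.1 = 0 then .inl x.2 else .inr x.2
  left_inv := by rintro (i | i) <;> simp
  right_inv := by
    rintro ⟨x, i⟩
    fin_cases x <;> simp

theorem lmiRep_blk (p t q : ι → ℤ) :
    LMIRep ι 1 (fun _ _ _ v => Blk (intComb p v) (intComb t v) (intComb q v)) := by
  refine ⟨Empty, inferInstance, fun _ => Sum.elim (fun i => !![p i, t i; t i, q i]) fun _ => 0,
    ?_, ?_⟩
  · rintro j (i | i)
    · ext a b
      fin_cases a <;> fin_cases b <;> rfl
    · exact i.elim
  · intro n _ _ v hv
    have key : fromBlocks (intComb p v) (intComb t v) (intComb t v) (intComb q v) =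
        (∑ i, toC !![p i, t i; t i, q i] ⊗ₖ v i).submatrix (finTwoProdEquiv n)
          (finTwoProdEquiv n) := by
      ext (a | a) (b | b) <;>
        simp [finTwoProdEquiv, toC, intComb, Matrix.sum_apply]
    change (fromBlocks (intComb p v) (intComb t v) (intComb t v) (intComb q v)).PosSemidef ↔ _
    rw [key, posSemidef_submatrix_equiv]
    simp only [Fintype.sum_sum_type, Sum.elim_inl, Finset.univ_eq_empty, Finset.sum_empty, add_zero]
    constructor
    · intro h
      exact ⟨Empty.elim, fun i => i.elim, fun _ => h⟩
    · rintro ⟨Z, -, h⟩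
      exact h 0

theorem lmiRep_blk_vars (a b c : ι) : LMIRep ι 1 (fun _ _ _ v => Blk (v a) (v b) (v c)) := by
  classical
  refine (lmiRep_blk (Pi.single a 1) (Pi.single b 1) (Pi.single c 1)).congr fun n _ _ v => ?_
  simp only [intComb_single]

theorem lmiRep_le (a b : ι) : LMIRep ι 1 (fun _ _ _ v => Blk (v a - v b) 0 (v a - v b)) := by
  classical
  refine (lmiRep_blk (Pi.single a 1 - Pi.single b 1) 0
    (Pi.single a 1 - Pi.single b 1)).congr fun n _ _ v => ?_
  simp only [intComb_sub, intComb_single, intComb_zero]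

theorem lmiRep_pair (a b : ι) : LMIRep ι 1 (fun _ _ _ v => Blk (v a) 0 (v b)) := by
  classical
  refine (lmiRep_blk (Pi.single a 1) 0 (Pi.single b 1)).congr fun n _ _ v => ?_
  simp only [intComb_single, intComb_zero]

/-- Two inequalities at the bottom and one per level. The induction generalizes `ι` because each
level binds a new variable. -/
theorem lmiRep_dyadic (l k : ℕ) (a b c : ι) :
    LMIRep ι (l + 2) (fun _ _ _ v => Dyadic l k (v a) (v b) (v c)) := by
  induction l generalizing k ι with
  | zero =>
    refine ((lmiRep_pair a b).and (lmiRep_le (if k = 0 then a else b) c)).congr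
      fun n _ _ v => ?_
    rw [Dyadic]
    split_ifs <;> rfl
  | succ l ih =>
    by_cases hk : k ≤ 2 ^ l
    · refine ((ih (ι := Option ι) k (some a) (some b) none).and
        (lmiRep_blk_vars (some a) (some c) none)).exists.congr fun n _ _ v => ?_
      rw [Dyadic, if_pos hk]
      rfl
    · refine ((ih (ι := Option ι) (k - 2 ^ l) (some a) (some b) none).and
        (lmiRep_blk_vars none (some c) (some b))).exists.congr fun n _ _ v => ?_
      rw [Dyadic, if_neg hk]
      rfl

theorem lmiRep_ratGeo (l k p : ℕ) (a b c : ι) :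
    LMIRep ι (2 * l + 5) (fun _ _ _ v => RatGeo l k p (v a) (v b) (v c)) := by
  have := ((lmiRep_dyadic (ι := Option (Option ι)) l k (some (some a)) (some none) none).and
    ((lmiRep_blk_vars none (some none) (some (some b))).and
      (lmiRep_dyadic l p (some (some a)) (some none) (some (some c))))).exists
  have h : l + 2 + (1 + (l + 2)) = 2 * l + 5 := by ring
  rw [h] at this
  exact this.exists

theorem lmiRep_geo (p q : ℕ) (a b c : ι) :
    LMIRep ι (2 * Nat.log 2 q + 5) (fun _ _ _ v => Geo p q (v a) (v b) (v c)) := by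
  unfold Geo
  split_ifs
  · exact lmiRep_ratGeo _ _ _ a b c
  · exact lmiRep_ratGeo _ _ _ b a c

theorem lmiRep_hyp (p q : ℕ) (a b c : ι) :
    LMIRep ι (2 * Nat.log 2 q + 6) (fun _ _ _ v => Hyp p q (v a) (v b) (v c)) :=
  ((lmiRep_geo (ι := Option ι) p q (some a) (some b) none).and (lmiRep_le none (some c))).exists

theorem lmiRep_epi (p q : ℕ) (a b c : ι) :
    LMIRep ι (2 * Nat.log 2 q + 6) (fun _ _ _ v => Epi p q (v a) (v b) (v c)) :=
  ((lmiRep_geo (ι := Option ι) p q (some a) (some b) none).and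
    (lmiRep_blk_vars (some c) (some a) none)).exists

/-- The block inequalities of a representation, at `X = ρ ⊗ I`, `Y = Ω`, `T = Θ`. -/
theorem LMIRep.exists_blockLMI {m : ℕ}
    {R : ∀ (n : Type) [Fintype n] [DecidableEq n], (Fin 3 → Matrix n n ℂ) → Prop}
    (h : LMIRep (Fin 3) m R) :
    ∃ (k : ℕ) (L : Fin m → BlockLMI k), ∀ (A B : Type) [Fintype A] [DecidableEq A] [Fintype B]
      [DecidableEq B] (ρ : Herm A) (Ω Θ : Herm (A × B)),
      R (A × B) ![(ρ : Matrix A A ℂ) ⊗ₖ (1 : Matrix B B ℂ), Ω, Θ] ↔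
        ∃ Z : Fin k → Herm (A × B), ∀ j, ((L j).eval (ρ, Ω, Θ, Z)).PosSemidef := by
  obtain ⟨κ, _, c, hc, h⟩ := h
  let e := Fintype.equivFin κ
  refine ⟨Fintype.card κ, fun j => ⟨c j (.inl 0), c j (.inl 1), c j (.inl 2),
    fun i => c j (.inr (e.symm i)), hc _ _, hc _ _, hc _ _, fun i => hc _ _⟩, ?_⟩
  intro A B _ _ _ _ ρ Ω Θ
  have hv : ∀ i, (![(ρ : Matrix A A ℂ) ⊗ₖ (1 : Matrix B B ℂ), Ω, Θ] i).IsHermitian := by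
    intro i
    fin_cases i
    · exact kronecker_isHermitian (herm_isHermitian _) isHermitian_one
    · exact herm_isHermitian _
    · exact herm_isHermitian _
  rw [h _ _ hv]
  have key : ∀ (Z : κ → Matrix (A × B) (A × B) ℂ) (Z' : Fin (Fintype.card κ) → Herm (A × B)) j,
      (∀ i, Z i = Z' (e i)) →
      BlockLMI.eval ⟨c j (.inl 0), c j (.inl 1), c j (.inl 2),
        fun i => c j (.inr (e.symm i)), hc _ _, hc _ _, hc _ _, fun i => hc _ _⟩ (ρ, Ω, Θ, Z') =
      ∑ i, toC (c j i) ⊗ₖ Sum.elim ![(ρ : Matrix A A ℂ) ⊗ₖ (1 : Matrix B B ℂ), Ω, Θ] Z i := by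
    intro Z Z' j hZ
    simp only [BlockLMI.eval, LinearMap.coe_mk, AddHom.coe_mk, Fintype.sum_sum_type,
      Fin.sum_univ_three, Sum.elim_inl, Sum.elim_inr, hZ]
    congr 1
    exact (Fintype.sum_equiv e _ _ fun i => by simp).symm
  constructor
  · rintro ⟨Z, hZ, hj⟩
    refine ⟨fun i => ⟨Z (e.symm i), hZ _⟩, fun j => ?_⟩
    rw [key Z _ j fun i => by simp]
    exact hj j
  · rintro ⟨Z, hj⟩
    refine ⟨fun i => Z (e i), fun i => herm_isHermitian _, fun j => ?_⟩
    rw [← key _ Z j fun i => rfl]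
    exact hj j

end Representability

end MeasuredRenyi
namespace MeasuredRenyi

open Matrix Filter Topology
open scoped MatrixOrder

/-! ### Choi operators and testers -/

section Testers

variable {A B R : Type} [Fintype A] [DecidableEq A] [Fintype B] [DecidableEq B] [Fintype R]
  [DecidableEq R]

theorem exists_eq_mul_conjTranspose {n : Type} [Fintype n] [DecidableEq n] {X : Matrix n n ℂ}
    (hX : X.PosSemidef) : ∃ K : Matrix n n ℂ, X = K * Kᴴ := by
  obtain ⟨K, hK⟩ := CStarAlgebra.nonneg_iff_eq_mul_star_self.1 hX.nonneg
  exact ⟨K, hK⟩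

theorem maxEntangled_apply (i a j a' : A) :
    maxEntangled A (i, a) (j, a') = single i j (1 : ℂ) a a' := by
  simp only [maxEntangled, Matrix.sum_apply, kroneckerMap_apply]
  rw [Finset.sum_eq_single i, Finset.sum_eq_single j]
  · simp
  · intro b _ hb
    simp [hb]
  · simp
  · intro b _ hb
    simp [hb]
  · simp

theorem choi_apply (N : Matrix A A ℂ →ₗ[ℂ] Matrix B B ℂ) (a a' : A) (b b' : B) :
    choi N (a, b) (a', b') = N (single a a' 1) b b' := by
  simp only [choi, ampliate, of_apply, maxEntangled_apply]
  rfl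

theorem maxEntangled_posSemidef : (maxEntangled A).PosSemidef := by
  have : maxEntangled A = vecMulVec (fun x : A × A => if x.1 = x.2 then (1 : ℂ) else 0)
      (star fun x : A × A => if x.1 = x.2 then (1 : ℂ) else 0) := by
    ext ⟨i, a⟩ ⟨j, a'⟩
    rw [maxEntangled_apply, vecMulVec_apply, Pi.star_apply, single_apply]
    by_cases h : i = a <;> by_cases h' : j = a' <;> simp [h, h']
  rw [this]
  exact posSemidef_vecMulVec_self_star _

theorem choi_posSemidef {N : Matrix A A ℂ →ₗ[ℂ] Matrix B B ℂ} (hN : IsCompletelyPositive N) :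
    (choi N).PosSemidef := by
  let e := Fintype.equivFin A
  have h := hN (Fintype.card A) ((maxEntangled A).submatrix (Prod.map e.symm id)
    (Prod.map e.symm id)) (maxEntangled_posSemidef.submatrix _)
  have := h.submatrix (Prod.map e id)
  convert this using 1
  ext ⟨a, b⟩ ⟨a', b'⟩
  simp [choi, ampliate]

theorem map_apply_eq_sum (N : Matrix A A ℂ →ₗ[ℂ] Matrix B B ℂ) (Y : Matrix A A ℂ) (b b' : B) :
    N Y b b' = ∑ a, ∑ a', Y a a' * choi N (a, b) (a', b') := by
  conv_lhs => rw [matrix_eq_sum_single Y]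
  simp only [map_sum, Matrix.sum_apply, choi_apply]
  refine Finset.sum_congr rfl fun a _ => Finset.sum_congr rfl fun a' _ => ?_
  have : single a a' (Y a a') = Y a a' • single a a' (1 : ℂ) := by simp
  rw [this, map_smul, Matrix.smul_apply, smul_eq_mul]

/-- The operator on `A ⊗ B` that describes the preparation of the state `ρ` followed by the
measurement of the effect `Λ` on the reference system and the channel output. -/
def contract (ρ : Matrix (R × A) (R × A) ℂ) (Λ : Matrix (R × B) (R × B) ℂ) :
    Matrix (A × B) (A × B) ℂ :=
  of fun i j => ∑ r, ∑ r', Λ (r, i.2) (r', j.2) * ρ (r', j.1) (r, i.1)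

/-- Both sides are the same sum over two indices of each of `R`, `A`, `B`, in different orders.
Outcome probabilities thus see the channel only through its Choi operator. -/
theorem trace_mul_ampliate (N : Matrix A A ℂ →ₗ[ℂ] Matrix B B ℂ) (ρ : Matrix (R × A) (R × A) ℂ)
    (Λ : Matrix (R × B) (R × B) ℂ) :
    (Λ * ampliate R N ρ).trace = (contract ρ Λ * choi N).trace := by
  have hL : (Λ * ampliate R N ρ).trace = ∑ x : R × B × R × B × A × A,
      Λ (x.1, x.2.1) (x.2.2.1, x.2.2.2.1) * (ρ (x.2.2.1, x.2.2.2.2.1) (x.1, x.2.2.2.2.2) *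
        choi N (x.2.2.2.2.1, x.2.2.2.1) (x.2.2.2.2.2, x.2.1)) := by
    simp only [trace, diag_apply, Matrix.mul_apply, Fintype.sum_prod_type, ampliate, of_apply,
      map_apply_eq_sum, Finset.mul_sum]
  have hR : (contract ρ Λ * choi N).trace = ∑ x : A × B × A × B × R × R,
      Λ (x.2.2.2.2.1, x.2.1) (x.2.2.2.2.2, x.2.2.2.1) *
        ρ (x.2.2.2.2.2, x.2.2.1) (x.2.2.2.2.1, x.1) *
        choi N (x.2.2.1, x.2.2.2.1) (x.1, x.2.1) := by
    simp only [trace, diag_apply, Matrix.mul_apply, Fintype.sum_prod_type, contract, of_apply,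
      Finset.sum_mul]
  rw [hL, hR]
  refine Fintype.sum_equiv
    ⟨fun x => (x.2.2.2.2.2, x.2.1, x.2.2.2.2.1, x.2.2.2.1, x.1, x.2.2.1),
      fun x => (x.2.2.2.2.1, x.2.1, x.2.2.2.2.2, x.2.2.2.1, x.2.2.1, x.1),
      fun _ => rfl, fun _ => rfl⟩ _ _ fun x => ?_
  exact (mul_assoc _ _ _).symm

/-- Writing `ρ = K Kᴴ`, each column of `K` contributes a congruence of `Λ`. -/
theorem contract_posSemidef {ρ : Matrix (R × A) (R × A) ℂ} {Λ : Matrix (R × B) (R × B) ℂ}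
    (hρ : ρ.PosSemidef) (hΛ : Λ.PosSemidef) : (contract ρ Λ).PosSemidef := by
  obtain ⟨K, rfl⟩ := exists_eq_mul_conjTranspose hρ
  have : contract (K * Kᴴ) Λ = ∑ s, (of fun (i : A × B) (j : R × B) =>
      if i.2 = j.2 then star (K (j.1, i.1) s) else 0) * Λ * (of fun (i : A × B) (j : R × B) =>
      if i.2 = j.2 then star (K (j.1, i.1) s) else 0)ᴴ := by
    ext ⟨a', b⟩ ⟨a, b'⟩
    simp only [contract, of_apply, Matrix.sum_apply, Matrix.mul_apply, conjTranspose_apply,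
      Fintype.sum_prod_type, ite_mul, zero_mul, Finset.sum_ite_eq, Finset.mem_univ, if_true,
      apply_ite star, star_star, star_zero, mul_ite, mul_zero, Finset.mul_sum, Finset.sum_mul]
    simp only [← Fintype.sum_prod_type']
    refine Fintype.sum_equiv ⟨fun x => (x.2.2.1, x.2.2.2, x.2.1, x.1),
      fun x => (x.2.2.2, x.2.2.1, x.1, x.2.1), fun _ => rfl, fun _ => rfl⟩ _ _ fun x => ?_
    simp only [Equiv.coe_fn_mk]
    ring
  rw [this]
  exact posSemidef_sum _ fun s _ => hΛ.mul_mul_conjTranspose_same _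

theorem contract_one (ρ : Matrix (R × A) (R × A) ℂ) :
    contract ρ (1 : Matrix (R × B) (R × B) ℂ) = (marginal ρ)ᵀ ⊗ₖ (1 : Matrix B B ℂ) := by
  ext ⟨a', b⟩ ⟨a, b'⟩
  simp only [contract, of_apply, one_apply, Prod.mk.injEq, kroneckerMap_apply, transpose_apply,
    marginal]
  by_cases h : b = b' <;> simp [h]

theorem contract_sum {k : ℕ} (ρ : Matrix (R × A) (R × A) ℂ)
    (Λ : Fin k → Matrix (R × B) (R × B) ℂ) :
    contract ρ (∑ x, Λ x) = ∑ x, contract ρ (Λ x) := by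
  ext i j
  simp only [contract, of_apply, Matrix.sum_apply, Finset.sum_mul]
  rw [Finset.sum_comm (s := (Finset.univ : Finset (Fin k)))]
  refine Finset.sum_congr rfl fun r _ => ?_
  rw [Finset.sum_comm]

/-- Collections of positive operators with sum `ρ ⊗ I`. -/
def IsTester {k : ℕ} (ρ : Matrix A A ℂ) (X : Fin k → Matrix (A × B) (A × B) ℂ) : Prop :=
  (∀ x, (X x).PosSemidef) ∧ ∑ x, X x = ρ ⊗ₖ (1 : Matrix B B ℂ)

theorem isTester_contract {k : ℕ} {ρ : Matrix (R × A) (R × A) ℂ}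
    {Λ : Fin k → Matrix (R × B) (R × B) ℂ} (hρ : ρ.PosSemidef) (hΛ : IsPOVM Λ) :
    IsTester (marginal ρ)ᵀ fun x => contract ρ (Λ x) :=
  ⟨fun x => contract_posSemidef hρ (hΛ.1 x), by rw [← contract_sum, hΛ.2, contract_one]⟩

theorem outcomeQuasi_ampliate {k : ℕ} (α : ℝ) (N M : Matrix A A ℂ →ₗ[ℂ] Matrix B B ℂ)
    (ρ : Matrix (R × A) (R × A) ℂ) (Λ : Fin k → Matrix (R × B) (R × B) ℂ) :
    outcomeQuasi α (ampliate R N ρ) (ampliate R M ρ) Λ =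
      outcomeQuasi α (choi N) (choi M) fun x => contract ρ (Λ x) := by
  simp only [outcomeQuasi, trace_mul_ampliate]

theorem marginal_posSemidef {ρ : Matrix (R × A) (R × A) ℂ} (hρ : ρ.PosSemidef) :
    (marginal ρ).PosSemidef := by
  have : marginal ρ = ∑ r, ρ.submatrix (fun a => (r, a)) (fun a => (r, a)) := by
    ext a a'
    simp [marginal, Matrix.sum_apply]
  rw [this]
  exact posSemidef_sum _ fun r _ => hρ.submatrix _

theorem trace_marginal (ρ : Matrix (R × A) (R × A) ℂ) : (marginal ρ).trace = ρ.trace := by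
  simp only [trace, diag_apply, marginal, of_apply, Fintype.sum_prod_type]
  rw [Finset.sum_comm]

/-- Every tester of a positive definite `ρ` arises from a state and a measurement. -/
theorem exists_contract_eq {k : ℕ} {ρ : Matrix A A ℂ} (hρ : ρ.PosDef)
    {X : Fin k → Matrix (A × B) (A × B) ℂ} (hX : IsTester ρ X) :
    ∃ (d : ℕ) (ψ : Matrix (Fin d × A) (Fin d × A) ℂ) (Λ : Fin k → Matrix (Fin d × B) (Fin d × B) ℂ),
      ψ.PosSemidef ∧ marginal ψ = ρᵀ ∧ IsPOVM Λ ∧ ∀ x, contract ψ (Λ x) = X x := by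
  obtain ⟨K, hK⟩ := exists_eq_mul_conjTranspose hρ.posSemidef
  have hKu : IsUnit K := by
    have h := hρ.isUnit
    rw [hK, isUnit_iff_isUnit_det, det_mul] at h
    exact (isUnit_iff_isUnit_det _).2 (isUnit_of_mul_isUnit_left h)
  have hKd := (isUnit_iff_isUnit_det _).1 hKu
  let e := Fintype.equivFin A
  -- `S` is a square root factor of `ρ`, `Sᴴ S = ρ`, with rows moved to `Fin` since reference
  -- systems are indexed by `Fin d`; `T` is its inverse.
  set S : Matrix (Fin (Fintype.card A)) A ℂ := Kᴴ.submatrix e.symm id with hS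
  set T : Matrix A (Fin (Fintype.card A)) ℂ := (K⁻¹)ᴴ.submatrix id e.symm with hT
  have hSS : Sᴴ * S = ρ := by
    rw [hS, conjTranspose_submatrix, conjTranspose_conjTranspose,
      submatrix_mul_equiv K Kᴴ id e.symm id, ← hK, submatrix_id_id]
  have hTS : T * S = 1 := by
    rw [hS, hT, submatrix_mul_equiv _ _ id e.symm id, ← conjTranspose_mul, mul_nonsing_inv _ hKd,
      conjTranspose_one, submatrix_id_id]
  have hST : S * T = 1 := by
    rw [hS, hT, submatrix_mul _ _ e.symm id e.symm Function.bijective_id |>.symm,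
      ← conjTranspose_mul, nonsing_inv_mul _ hKd, conjTranspose_one, submatrix_one_equiv]
  -- The pure state with amplitudes `S` contracts `L` to `(S ⊗ 1)ᴴ L (S ⊗ 1)`; the effects undo this
  -- congruence, and sum to `1` because `X` sums to `Sᴴ S ⊗ 1`.
  refine ⟨Fintype.card A, vecMulVec (fun x => S x.1 x.2) (star fun x => S x.1 x.2),
    fun x => (T ⊗ₖ (1 : Matrix B B ℂ))ᴴ * X x * (T ⊗ₖ (1 : Matrix B B ℂ)),
    posSemidef_vecMulVec_self_star _, ?_, ⟨fun x => (hX.1 x).conjTranspose_mul_mul_same _, ?_⟩,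
    fun x => ?_⟩
  · ext a a'
    rw [← hSS]
    simp only [marginal, of_apply, vecMulVec_apply, Pi.star_apply, transpose_apply,
      Matrix.mul_apply, conjTranspose_apply]
    exact Finset.sum_congr rfl fun r _ => mul_comm _ _
  · rw [← Matrix.sum_mul, ← Matrix.mul_sum, hX.2, ← hSS, conjTranspose_kronecker,
      ← mul_kronecker_mul, ← mul_kronecker_mul, Matrix.mul_assoc, Matrix.mul_assoc, hST,
      Matrix.mul_one, ← conjTranspose_mul, hST]
    simp
  · have key : ∀ L : Matrix (Fin (Fintype.card A) × B) (Fin (Fintype.card A) × B) ℂ,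
        contract (vecMulVec (fun x => S x.1 x.2) (star fun x => S x.1 x.2)) L =
          (S ⊗ₖ (1 : Matrix B B ℂ))ᴴ * L * (S ⊗ₖ (1 : Matrix B B ℂ)) := by
      intro L
      ext ⟨a', b⟩ ⟨a, b'⟩
      simp only [contract, of_apply, vecMulVec_apply, Pi.star_apply, Matrix.mul_apply,
        conjTranspose_apply, kroneckerMap_apply, one_apply, Fintype.sum_prod_type]
      simp only [apply_ite star, star_zero, mul_ite, ite_mul, mul_zero, mul_one, zero_mul, Finset.sum_ite_eq', Finset.mem_univ, if_true]
      rw [Finset.sum_comm]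
      refine Finset.sum_congr rfl fun r _ => ?_
      rw [Finset.sum_mul]
      exact Finset.sum_congr rfl fun r' _ => by ring
    have h1 : (T ⊗ₖ (1 : Matrix B B ℂ)) * (S ⊗ₖ (1 : Matrix B B ℂ)) = 1 := by
      rw [← mul_kronecker_mul, hTS]
      simp
    have h2 : (S ⊗ₖ (1 : Matrix B B ℂ))ᴴ * (T ⊗ₖ (1 : Matrix B B ℂ))ᴴ = 1 := by
      rw [← conjTranspose_mul, h1, conjTranspose_one]
    rw [key]
    simp only [Matrix.mul_assoc]
    rw [h1, Matrix.mul_one, ← Matrix.mul_assoc, h2, Matrix.one_mul]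

end Testers

end MeasuredRenyi
namespace MeasuredRenyi

open Matrix Filter Topology
open scoped MatrixOrder

/-! ### Scalar variational formulas -/

section Scalars

/-- The scalar objective `α p c^{1-α} + (1-α) q c^{-α}`. -/
noncomputable def scalarObj (α p q c : ℝ) : ℝ :=
  α * (c ^ (1 - α) * p) + (1 - α) * (c ^ (-α) * q)

theorem ofReal_rpow_mul {α p q : ℝ} (hp : 0 < p) (hq : 0 < q) :
    ENNReal.ofReal p ^ α * ENNReal.ofReal q ^ (1 - α) =
      ENNReal.ofReal (p ^ α * q ^ (1 - α)) := by
  rw [ENNReal.ofReal_rpow_of_pos hp, ENNReal.ofReal_rpow_of_pos hq,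
    ENNReal.ofReal_mul (Real.rpow_nonneg hp.le _)]

/-- Weighted AM-GM for `c^(1-α) p` and `c^(-α) q`; the powers of `c` cancel in the geometric mean.
-/
theorem rpow_mul_le_scalarObj {α p q c : ℝ} (h0 : 0 < α) (h1 : α < 1) (hp : 0 ≤ p) (hq : 0 ≤ q)
    (hc : 0 < c) :
    ((ENNReal.ofReal p ^ α * ENNReal.ofReal q ^ (1 - α) : ℝ≥0∞) : EReal) ≤
      (scalarObj α p q c : EReal) := by
  have hc1 := Real.rpow_pos_of_pos hc (1 - α)
  have hc2 := Real.rpow_pos_of_pos hc (-α)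
  have h := Real.geom_mean_le_arith_mean2_weighted h0.le (sub_pos.2 h1).le
    (mul_nonneg hc1.le hp) (mul_nonneg hc2.le hq) (by ring)
  rw [Real.mul_rpow hc1.le hp, Real.mul_rpow hc2.le hq, mul_mul_mul_comm, ← Real.rpow_mul hc.le,
    ← Real.rpow_mul hc.le, ← Real.rpow_add hc] at h
  have h2 : (1 - α) * α + -α * (1 - α) = 0 := by ring
  rw [h2, Real.rpow_zero, one_mul] at h
  rw [ENNReal.ofReal_rpow_of_nonneg hp h0.le, ENNReal.ofReal_rpow_of_nonneg hq (sub_pos.2 h1).le,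
    ← ENNReal.ofReal_mul (Real.rpow_nonneg hp _), EReal.coe_ennreal_ofReal,
    max_eq_left (mul_nonneg (Real.rpow_nonneg hp _) (Real.rpow_nonneg hq _))]
  exact EReal.coe_le_coe_iff.2 h

/-- With `v = p^α q^(1-α)`, the number `c^(1-α) p` is the geometric mean of `v` and `c^(-α) q` with
weights `1/α` and `1 - 1/α`; AM-GM is then solved for `v`. -/
theorem scalarObj_le_rpow_mul {α p q c : ℝ} (h1 : 1 < α) (hp : 0 ≤ p) (hq : 0 ≤ q)
    (hc : 0 < c) :
    (scalarObj α p q c : EReal) ≤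
      ((ENNReal.ofReal p ^ α * ENNReal.ofReal q ^ (1 - α) : ℝ≥0∞) : EReal) := by
  have h0 : 0 < α := by linarith
  have hc1 := Real.rpow_pos_of_pos hc (1 - α)
  have hc2 := Real.rpow_pos_of_pos hc (-α)
  rcases hp.eq_or_lt with rfl | hp
  · refine le_trans (b := ((0 : ℝ) : EReal)) (EReal.coe_le_coe_iff.2 ?_)
      (by rw [EReal.coe_zero]; exact EReal.coe_ennreal_nonneg _)
    simp only [scalarObj, mul_zero, zero_add]
    exact mul_nonpos_of_nonpos_of_nonneg (by linarith) (mul_nonneg hc2.le hq)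
  rcases hq.eq_or_lt with rfl | hq
  · rw [ENNReal.ofReal_zero, ENNReal.zero_rpow_of_neg (by linarith), ENNReal.mul_top]
    · simp
    · rw [ENNReal.ofReal_rpow_of_pos hp]
      simpa using Real.rpow_pos_of_pos hp α
  rw [ofReal_rpow_mul hp hq, EReal.coe_ennreal_ofReal]
  refine EReal.coe_le_coe_iff.2 (le_max_of_le_left ?_)
  set v := p ^ α * q ^ (1 - α) with hv
  have hv0 : 0 < v := mul_pos (Real.rpow_pos_of_pos hp _) (Real.rpow_pos_of_pos hq _)
  have h := Real.geom_mean_le_arith_mean2_weighted (w₁ := 1 / α) (w₂ := 1 - 1 / α)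
    (by positivity) (by rw [sub_nonneg, div_le_one h0]; exact h1.le)
    hv0.le (mul_nonneg hc2.le hq.le) (by ring)
  have hg : v ^ (1 / α) * (c ^ (-α) * q) ^ (1 - 1 / α) = c ^ (1 - α) * p := by
    rw [hv, Real.mul_rpow (Real.rpow_nonneg hp.le _) (Real.rpow_nonneg hq.le _),
      Real.mul_rpow hc2.le hq.le, ← Real.rpow_mul hp.le, ← Real.rpow_mul hq.le,
      ← Real.rpow_mul hc.le]
    have e1 : α * (1 / α) = 1 := by field_simp
    have e2 : (1 - α) * (1 / α) = -(1 - 1 / α) := by field_simp; ring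
    have e3 : -α * (1 - 1 / α) = 1 - α := by field_simp; ring
    rw [e1, e2, e3, Real.rpow_one, Real.rpow_neg hq.le]
    have := (Real.rpow_pos_of_pos hq (1 - 1 / α)).ne'
    field_simp
  rw [hg] at h
  have h' := mul_le_mul_of_nonneg_left h h0.le
  have e : α * (1 / α * v + (1 - 1 / α) * (c ^ (-α) * q)) = v + (α - 1) * (c ^ (-α) * q) := by
    field_simp
  rw [e] at h'
  unfold scalarObj
  linarith

/-- The optimum is `c = q / p`. If `p = 0` it escapes to `c → ∞`; if only `q = 0`, to `c → 0`, where
the limit is `0` or `∞` according to `α`. Hence a sequence. -/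
theorem exists_tendsto_scalarObj {α p q : ℝ} (h0 : 0 < α) (h1 : α ≠ 1) (hp : 0 ≤ p)
    (hq : 0 ≤ q) : ∃ c : ℕ → ℝ, (∀ k, 0 < c k) ∧
      Tendsto (fun k => (scalarObj α p q (c k) : EReal)) atTop
        (𝓝 ((ENNReal.ofReal p ^ α * ENNReal.ofReal q ^ (1 - α) : ℝ≥0∞) : EReal)) := by
  have hnat : Tendsto (fun k : ℕ => (k : ℝ) + 1) atTop atTop :=
    tendsto_atTop_add_const_right _ _ tendsto_natCast_atTop_atTop
  rcases hp.eq_or_lt with rfl | hp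
  · refine ⟨fun k => (k : ℝ) + 1, fun k => by positivity, ?_⟩
    rw [ENNReal.ofReal_zero, ENNReal.zero_rpow_of_pos h0, zero_mul, EReal.coe_ennreal_zero,
      ← EReal.coe_zero]
    refine (continuous_coe_real_ereal.tendsto 0).comp ?_
    have := (tendsto_rpow_neg_atTop h0).comp hnat
    simpa [scalarObj] using (this.mul_const q).const_mul (1 - α)
  rcases hq.eq_or_lt with rfl | hq
  · rcases lt_or_gt_of_ne h1 with h1 | h1
    · refine ⟨fun k => ((k : ℝ) + 1)⁻¹, fun k => by positivity, ?_⟩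
      rw [ENNReal.ofReal_zero, ENNReal.zero_rpow_of_pos (sub_pos.2 h1), mul_zero,
        EReal.coe_ennreal_zero, ← EReal.coe_zero]
      refine (continuous_coe_real_ereal.tendsto 0).comp ?_
      have := (tendsto_rpow_neg_atTop (sub_pos.2 h1)).comp hnat
      have h2 := (this.mul_const p).const_mul α
      simp only [zero_mul, mul_zero] at h2
      refine h2.congr fun k => ?_
      have hk : (0 : ℝ) ≤ (k : ℝ) + 1 := by positivity
      simp only [scalarObj, Function.comp, mul_zero, add_zero, Real.inv_rpow hk,
        Real.rpow_neg hk]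
    · refine ⟨fun k => ((k : ℝ) + 1)⁻¹, fun k => by positivity, ?_⟩
      rw [ENNReal.ofReal_zero, ENNReal.zero_rpow_of_neg (by linarith), ENNReal.mul_top]
      · rw [EReal.coe_ennreal_top, EReal.tendsto_coe_nhds_top_iff]
        have := (tendsto_rpow_atTop (sub_pos.2 h1)).comp hnat
        have h2 := (this.atTop_mul_const hp).const_mul_atTop h0
        refine h2.congr fun k => ?_
        have hk : (0 : ℝ) ≤ (k : ℝ) + 1 := by positivity
        simp only [scalarObj, Function.comp, mul_zero, add_zero, Real.inv_rpow hk]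
        rw [← Real.rpow_neg hk, neg_sub]
      · rw [ENNReal.ofReal_rpow_of_pos hp]
        simpa using Real.rpow_pos_of_pos hp α
  · refine ⟨fun _ => q / p, fun _ => div_pos hq hp, ?_⟩
    rw [ofReal_rpow_mul hp hq, EReal.coe_ennreal_ofReal,
      max_eq_left (mul_nonneg (Real.rpow_nonneg hp.le _) (Real.rpow_nonneg hq.le _))]
    have : scalarObj α p q (q / p) = p ^ α * q ^ (1 - α) := by
      unfold scalarObj
      rw [Real.div_rpow hq.le hp.le, Real.div_rpow hq.le hp.le]
      have e1 : q ^ (1 - α) / p ^ (1 - α) * p = p ^ α * q ^ (1 - α) := by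
        rw [Real.rpow_sub hp, Real.rpow_one]
        have := (Real.rpow_pos_of_pos hp α).ne'
        field_simp
      have e2 : q ^ (-α) / p ^ (-α) * q = p ^ α * q ^ (1 - α) := by
        rw [Real.rpow_neg hp.le, Real.rpow_neg hq.le, Real.rpow_sub hq, Real.rpow_one]
        have := (Real.rpow_pos_of_pos hp α).ne'
        have := (Real.rpow_pos_of_pos hq α).ne'
        field_simp
      rw [e1, e2]
      ring
    simp only [this]
    exact tendsto_const_nhds

theorem coe_ereal_sum {ι : Type} (s : Finset ι) (f : ι → ℝ) :
    ((∑ x ∈ s, f x : ℝ) : EReal) = ∑ x ∈ s, (f x : EReal) := by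
  classical
  induction s using Finset.induction_on with
  | empty => simp
  | insert a s ha ih => rw [Finset.sum_insert ha, Finset.sum_insert ha, EReal.coe_add, ih]

theorem coe_ennreal_ereal_sum {ι : Type} (s : Finset ι) (f : ι → ℝ≥0∞) :
    ((∑ x ∈ s, f x : ℝ≥0∞) : EReal) = ∑ x ∈ s, (f x : EReal) := by
  classical
  induction s using Finset.induction_on with
  | empty => simp
  | insert a s ha ih => rw [Finset.sum_insert ha, Finset.sum_insert ha, EReal.coe_ennreal_add, ih]

theorem tendsto_coe_ereal_sum {ι : Type} (s : Finset ι) {f : ι → ℕ → ℝ} {v : ι → ℝ≥0∞}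
    (h : ∀ x, Tendsto (fun k => (f x k : EReal)) atTop (𝓝 (v x : EReal))) :
    Tendsto (fun k => ((∑ x ∈ s, f x k : ℝ) : EReal)) atTop
      (𝓝 ((∑ x ∈ s, v x : ℝ≥0∞) : EReal)) := by
  classical
  induction s using Finset.induction_on with
  | empty => simp
  | insert a s ha ih =>
    simp only [Finset.sum_insert ha, EReal.coe_add, EReal.coe_ennreal_add]
    exact (EReal.continuousAt_add (p := ((v a : EReal), ((∑ x ∈ s, v x : ℝ≥0∞) : EReal)))
      (Or.inr (EReal.coe_ennreal_ne_bot _)) (Or.inl (EReal.coe_ennreal_ne_bot _))).tendsto.comp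
      ((h a).prodMk_nhds ih)

/-- A bound that holds for all proper mixtures with a second point holds for the first point. -/
theorem EReal_le_of_forall_mix {b : EReal} {x y : ℝ}
    (h : ∀ ε : ℝ, 0 < ε → ε ≤ 1 → b ≤ (((1 - ε) * x + ε * y : ℝ) : EReal)) : b ≤ (x : EReal) := by
  have hε : Tendsto (fun k : ℕ => 1 / ((k : ℝ) + 1)) atTop (𝓝 0) :=
    tendsto_one_div_add_atTop_nhds_zero_nat
  have hc : Continuous fun ε : ℝ => (((1 - ε) * x + ε * y : ℝ) : EReal) :=
    continuous_coe_real_ereal.comp (by fun_prop)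
  have := (hc.tendsto 0).comp hε
  simp only [sub_zero, one_mul, zero_mul, add_zero] at this
  refine ge_of_tendsto' this fun k => h _ (by positivity) ?_
  rw [div_le_one (by positivity)]
  simp

theorem EReal_ge_of_forall_mix {b : EReal} {x y : ℝ}
    (h : ∀ ε : ℝ, 0 < ε → ε ≤ 1 → (((1 - ε) * x + ε * y : ℝ) : EReal) ≤ b) : (x : EReal) ≤ b := by
  have hε : Tendsto (fun k : ℕ => 1 / ((k : ℝ) + 1)) atTop (𝓝 0) :=
    tendsto_one_div_add_atTop_nhds_zero_nat
  have hc : Continuous fun ε : ℝ => (((1 - ε) * x + ε * y : ℝ) : EReal) :=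
    continuous_coe_real_ereal.comp (by fun_prop)
  have := (hc.tendsto 0).comp hε
  simp only [sub_zero, one_mul, zero_mul, add_zero] at this
  refine le_of_tendsto' this fun k => h _ (by positivity) ?_
  rw [div_le_one (by positivity)]
  simp

end Scalars

/-! ### The channel quantity as an optimization over testers -/

section TesterValue

variable {A B : Type} [Fintype A] [DecidableEq A] [Fintype B] [DecidableEq B]

theorem trace_mul_re_nonneg {n : Type} [Fintype n] [DecidableEq n] {X P : Matrix n n ℂ}
    (hX : X.PosSemidef) (hP : P.PosSemidef) : 0 ≤ (X * P).trace.re := by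
  obtain ⟨K, rfl⟩ := exists_eq_mul_conjTranspose hX
  rw [Matrix.mul_assoc, trace_mul_comm]
  exact (Complex.le_def.1 (hP.conjTranspose_mul_mul_same K).trace_nonneg).1

/-- The objective of a tester `X` with parameters `c`. -/
noncomputable def testerObj {n : Type} [Fintype n] {k : ℕ} (α : ℝ) (P Q : Matrix n n ℂ)
    (X : Fin k → Matrix n n ℂ) (c : Fin k → ℝ) : ℝ :=
  ∑ x, scalarObj α (X x * P).trace.re (X x * Q).trace.re (c x)

theorem testerObj_mix {n : Type} [Fintype n] {k : ℕ} (α : ℝ) (P Q : Matrix n n ℂ)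
    (X Y : Fin k → Matrix n n ℂ) (c : Fin k → ℝ) (r s : ℝ) :
    testerObj α P Q (fun x => (r : ℂ) • X x + (s : ℂ) • Y x) c =
      r * testerObj α P Q X c + s * testerObj α P Q Y c := by
  simp only [testerObj, scalarObj, Matrix.add_mul, Matrix.smul_mul, trace_add, trace_smul,
    Complex.add_re, smul_eq_mul, Complex.re_ofReal_mul, Finset.mul_sum, ← Finset.sum_add_distrib]
  exact Finset.sum_congr rfl fun x _ => by ring

theorem outcomeQuasi_le_testerObj {n : Type} [Fintype n] [DecidableEq n] {k : ℕ} {α : ℝ}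
    (h0 : 0 < α) (h1 : α < 1) {P Q : Matrix n n ℂ} (hP : P.PosSemidef) (hQ : Q.PosSemidef)
    {X : Fin k → Matrix n n ℂ} (hX : ∀ x, (X x).PosSemidef) {c : Fin k → ℝ} (hc : ∀ x, 0 < c x) :
    (outcomeQuasi α P Q X : EReal) ≤ (testerObj α P Q X c : EReal) := by
  rw [outcomeQuasi, testerObj, coe_ennreal_ereal_sum, coe_ereal_sum]
  exact Finset.sum_le_sum fun x _ => rpow_mul_le_scalarObj h0 h1 (trace_mul_re_nonneg (hX x) hP)
    (trace_mul_re_nonneg (hX x) hQ) (hc x)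

theorem testerObj_le_outcomeQuasi {n : Type} [Fintype n] [DecidableEq n] {k : ℕ} {α : ℝ}
    (h1 : 1 < α) {P Q : Matrix n n ℂ} (hP : P.PosSemidef) (hQ : Q.PosSemidef)
    {X : Fin k → Matrix n n ℂ} (hX : ∀ x, (X x).PosSemidef) {c : Fin k → ℝ} (hc : ∀ x, 0 < c x) :
    (testerObj α P Q X c : EReal) ≤ (outcomeQuasi α P Q X : EReal) := by
  rw [outcomeQuasi, testerObj, coe_ennreal_ereal_sum, coe_ereal_sum]
  exact Finset.sum_le_sum fun x _ => scalarObj_le_rpow_mul h1 (trace_mul_re_nonneg (hX x) hP)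
    (trace_mul_re_nonneg (hX x) hQ) (hc x)

theorem exists_tendsto_testerObj {n : Type} [Fintype n] [DecidableEq n] {k : ℕ} {α : ℝ}
    (h0 : 0 < α) (h1 : α ≠ 1) {P Q : Matrix n n ℂ} (hP : P.PosSemidef) (hQ : Q.PosSemidef)
    {X : Fin k → Matrix n n ℂ} (hX : ∀ x, (X x).PosSemidef) :
    ∃ c : ℕ → Fin k → ℝ, (∀ j x, 0 < c j x) ∧
      Tendsto (fun j => (testerObj α P Q X (c j) : EReal)) atTop
        (𝓝 (outcomeQuasi α P Q X : EReal)) := by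
  choose c hc hl using fun x => exists_tendsto_scalarObj h0 h1
    (trace_mul_re_nonneg (hX x) hP) (trace_mul_re_nonneg (hX x) hQ)
  exact ⟨fun j x => c x j, fun j x => hc x j, tendsto_coe_ereal_sum _ hl⟩

/-- The energy constraint, for positive definite input states. -/
def IsInput (H : Matrix A A ℂ) (E : ℝ) (ρ : Matrix A A ℂ) : Prop :=
  ρ.PosDef ∧ ρ.trace = 1 ∧ (Hᵀ * ρ).trace.re ≤ E

theorem trace_transpose_mul (H ρ : Matrix A A ℂ) : (Hᵀ * ρᵀ).trace = (H * ρ).trace := by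
  rw [← transpose_mul, trace_transpose, trace_mul_comm]

/-- If there is an input state at all, then there is a positive definite one. -/
def HasInterior (H : Matrix A A ℂ) (E : ℝ) : Prop :=
  (∃ ρ : Matrix A A ℂ, IsDensity ρ ∧ (H * ρ).trace.re ≤ E) →
    ∃ ρ : Matrix A A ℂ, IsDensity ρ ∧ (H * ρ).trace.re ≤ E ∧ ρ.PosDef

theorem HasInterior.exists_isInput {H : Matrix A A ℂ} {E : ℝ} (h : HasInterior H E)
    {ρ : Matrix A A ℂ} (hρ : IsDensity ρ) (hE : (H * ρ).trace.re ≤ E) : ∃ τ, IsInput H E τ := by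
  obtain ⟨τ, h1, h2, h3⟩ := h ⟨ρ, hρ, hE⟩
  exact ⟨τᵀ, h3.transpose, by rw [trace_transpose, h1.2], by rwa [trace_transpose_mul]⟩

theorem IsInput.mix {H : Matrix A A ℂ} {E : ℝ} {ρ τ : Matrix A A ℂ} (hτ : IsInput H E τ)
    (h1 : ρ.PosSemidef) (h2 : ρ.trace = 1) (h3 : (Hᵀ * ρ).trace.re ≤ E) {ε : ℝ} (hε : 0 < ε)
    (hε1 : ε ≤ 1) : IsInput H E (((1 - ε : ℝ) : ℂ) • ρ + (ε : ℂ) • τ) := by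
  refine ⟨PosDef.posSemidef_add (h1.smul (Complex.zero_le_real.2 (sub_nonneg.2 hε1)))
    (hτ.1.smul (by simpa using hε)), ?_, ?_⟩
  · rw [trace_add, trace_smul, trace_smul, h2, hτ.2.1]
    simp
  · rw [Matrix.mul_add, Matrix.mul_smul, Matrix.mul_smul, trace_add, trace_smul, trace_smul,
      smul_eq_mul, smul_eq_mul, Complex.add_re, Complex.re_ofReal_mul, Complex.re_ofReal_mul]
    nlinarith [hτ.2.2, mul_le_mul_of_nonneg_left h3 (sub_nonneg.2 hε1),
      mul_le_mul_of_nonneg_left hτ.2.2 hε.le]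

theorem IsTester.mix [Nonempty B] {k : ℕ} {ρ τ : Matrix A A ℂ}
    {X : Fin k → Matrix (A × B) (A × B) ℂ} (hX : IsTester ρ X) (hρ : ρ.trace = 1)
    (hτ : τ.PosSemidef) : ∃ Y : Fin k → Matrix (A × B) (A × B) ℂ,
      ∀ ε : ℝ, 0 ≤ ε → ε ≤ 1 → IsTester (((1 - ε : ℝ) : ℂ) • ρ + (ε : ℂ) • τ)
        fun x => ((1 - ε : ℝ) : ℂ) • X x + (ε : ℂ) • Y x := by
  -- An empty tester would give `ρ ⊗ 1 = 0`, contradicting trace one. So an outcome exists to carry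
  -- all of `τ ⊗ 1`, which yields a tester of `τ` with the same outcomes.
  have hk : k ≠ 0 := by
    rintro rfl
    have h := hX.2
    rw [Finset.univ_eq_empty, Finset.sum_empty] at h
    have h' := congrArg trace h
    rw [trace_kronecker, hρ, trace_one, trace_zero, one_mul] at h'
    exact Fintype.card_ne_zero (by exact_mod_cast h'.symm)
  have : NeZero k := ⟨hk⟩
  refine ⟨Pi.single 0 (τ ⊗ₖ (1 : Matrix B B ℂ)), fun ε h0 h1 => ⟨fun x => ?_, ?_⟩⟩
  · refine ((hX.1 x).smul (Complex.zero_le_real.2 (sub_nonneg.2 h1))).add (PosSemidef.smul ?_ (by simpa using h0))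
    by_cases h : x = 0
    · subst h
      simpa using hτ.kronecker PosSemidef.one
    · simpa [h] using PosSemidef.zero
  · rw [Finset.sum_add_distrib, ← Finset.smul_sum, ← Finset.smul_sum, hX.2,
      Finset.sum_pi_single', if_pos (Finset.mem_univ _), add_kronecker, smul_kronecker,
      smul_kronecker]

/-- `Y` does not depend on `ε`, so for fixed parameters the objective of the mixture is affine in
`ε` and tends to that of `X`. -/
theorem testerObj_mix_bound [Nonempty B] {H : Matrix A A ℂ} {E : ℝ} {ρ : Matrix A A ℂ} {k : ℕ}
    (hE : HasInterior H E) (h1 : ρ.PosSemidef) (h2 : ρ.trace = 1) (h3 : (Hᵀ * ρ).trace.re ≤ E)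
    {X : Fin k → Matrix (A × B) (A × B) ℂ} (hX : IsTester ρ X) :
    ∃ Y : Fin k → Matrix (A × B) (A × B) ℂ, ∀ ε : ℝ, 0 < ε → ε ≤ 1 →
      ∃ σ, IsInput H E σ ∧ IsTester σ fun x => ((1 - ε : ℝ) : ℂ) • X x + (ε : ℂ) • Y x := by
  obtain ⟨τ, hτ⟩ := hE.exists_isInput (ρ := ρᵀ) ⟨h1.transpose, by rw [trace_transpose, h2]⟩
    (by rwa [← trace_transpose_mul, transpose_transpose])
  obtain ⟨Y, hY⟩ := hX.mix h2 hτ.1.posSemidef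
  exact ⟨Y, fun ε h h' => ⟨_, hτ.mix h1 h2 h3 h h', hY ε h.le h'⟩⟩

/-! ### Comparison of the channel quantity with tester objectives. -/

section

variable {N M : Matrix A A ℂ →ₗ[ℂ] Matrix B B ℂ} {H : Matrix A A ℂ} {E α : ℝ}

theorem channelQuasi_le_testerObj (h0 : 0 < α) (h1 : α < 1) (hN : (choi N).PosSemidef)
    (hM : (choi M).PosSemidef) {ρ : Matrix A A ℂ} (hρ : IsInput H E ρ) {k : ℕ}
    {X : Fin k → Matrix (A × B) (A × B) ℂ} (hX : IsTester ρ X) {c : Fin k → ℝ}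
    (hc : ∀ x, 0 < c x) :
    channelQuasi α H E N M ≤ (testerObj α (choi N) (choi M) X c : EReal) := by
  obtain ⟨d, ψ, Λ, hψ, hψρ, hΛ, hX'⟩ := exists_contract_eq hρ.1 hX
  refine le_trans ?_ (outcomeQuasi_le_testerObj h0 h1 hN hM hX.1 hc)
  rw [channelQuasi, if_pos h1]
  refine iInf_le_of_le d (iInf_le_of_le ψ (iInf_le_of_le ⟨⟨hψ, ?_⟩, ?_⟩ ?_))
  · rw [← trace_marginal, hψρ, trace_transpose, hρ.2.1]
  · rw [hψρ, ← trace_transpose_mul, transpose_transpose]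
    exact hρ.2.2
  · rw [EReal.coe_ennreal_le_coe_ennreal_iff, stateQuasi, if_pos h1]
    refine iInf_le_of_le k (iInf_le_of_le Λ (iInf_le_of_le hΛ ?_))
    rw [outcomeQuasi_ampliate]
    simp only [hX', le_refl]

theorem testerObj_le_channelQuasi (h1 : 1 < α) (hN : (choi N).PosSemidef)
    (hM : (choi M).PosSemidef) {ρ : Matrix A A ℂ} (hρ : IsInput H E ρ) {k : ℕ}
    {X : Fin k → Matrix (A × B) (A × B) ℂ} (hX : IsTester ρ X) {c : Fin k → ℝ}
    (hc : ∀ x, 0 < c x) :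
    (testerObj α (choi N) (choi M) X c : EReal) ≤ channelQuasi α H E N M := by
  obtain ⟨d, ψ, Λ, hψ, hψρ, hΛ, hX'⟩ := exists_contract_eq hρ.1 hX
  refine le_trans (testerObj_le_outcomeQuasi h1 hN hM hX.1 hc) ?_
  rw [channelQuasi, if_neg h1.not_gt]
  refine le_iSup_of_le d (le_iSup_of_le ψ (le_iSup_of_le ⟨⟨hψ, ?_⟩, ?_⟩ ?_))
  · rw [← trace_marginal, hψρ, trace_transpose, hρ.2.1]
  · rw [hψρ, ← trace_transpose_mul, transpose_transpose]
    exact hρ.2.2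
  · rw [EReal.coe_ennreal_le_coe_ennreal_iff, stateQuasi, if_neg h1.not_gt]
    refine le_iSup_of_le k (le_iSup_of_le Λ (le_iSup_of_le hΛ ?_))
    rw [outcomeQuasi_ampliate]
    simp only [hX', le_refl]

/-- Two limits in order: `ε → 0` at fixed parameters, where the objective is finite and affine, and
then the parameters towards their optimum, where it may diverge. -/
theorem le_outcomeQuasi_of_forall [Nonempty B] (h0 : 0 < α) (h1 : α ≠ 1)
    (hN : (choi N).PosSemidef) (hM : (choi M).PosSemidef) (hE : HasInterior H E) {b : EReal}
    (hb : ∀ (ρ : Matrix A A ℂ) (k : ℕ) (X : Fin k → Matrix (A × B) (A × B) ℂ) (c : Fin k → ℝ),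
      IsInput H E ρ → IsTester ρ X → (∀ x, 0 < c x) →
        b ≤ (testerObj α (choi N) (choi M) X c : EReal)) {d k : ℕ}
    {ρ : Matrix (Fin d × A) (Fin d × A) ℂ} (hρ : IsDensity ρ)
    (hρE : (H * marginal ρ).trace.re ≤ E) {Λ : Fin k → Matrix (Fin d × B) (Fin d × B) ℂ}
    (hΛ : IsPOVM Λ) :
    b ≤ (outcomeQuasi α (ampliate (Fin d) N ρ) (ampliate (Fin d) M ρ) Λ : EReal) := by
  have hX := isTester_contract hρ.1 hΛ
  rw [outcomeQuasi_ampliate]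
  obtain ⟨c, hc, hl⟩ := exists_tendsto_testerObj h0 h1 hN hM hX.1
  obtain ⟨Y, hY⟩ := testerObj_mix_bound hE (marginal_posSemidef hρ.1).transpose
    (by rw [trace_transpose, trace_marginal, hρ.2]) (by rwa [trace_transpose_mul]) hX
  refine ge_of_tendsto' hl fun j => EReal_le_of_forall_mix
    (y := testerObj α (choi N) (choi M) Y (c j)) fun ε h h' => ?_
  obtain ⟨σ, hσ, hσX⟩ := hY ε h h'
  rw [← testerObj_mix]
  exact hb σ k _ _ hσ hσX (hc j)

theorem outcomeQuasi_le_of_forall [Nonempty B] (h0 : 0 < α) (h1 : α ≠ 1)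
    (hN : (choi N).PosSemidef) (hM : (choi M).PosSemidef) (hE : HasInterior H E) {b : EReal}
    (hb : ∀ (ρ : Matrix A A ℂ) (k : ℕ) (X : Fin k → Matrix (A × B) (A × B) ℂ) (c : Fin k → ℝ),
      IsInput H E ρ → IsTester ρ X → (∀ x, 0 < c x) →
        (testerObj α (choi N) (choi M) X c : EReal) ≤ b) {d k : ℕ}
    {ρ : Matrix (Fin d × A) (Fin d × A) ℂ} (hρ : IsDensity ρ)
    (hρE : (H * marginal ρ).trace.re ≤ E) {Λ : Fin k → Matrix (Fin d × B) (Fin d × B) ℂ}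
    (hΛ : IsPOVM Λ) :
    (outcomeQuasi α (ampliate (Fin d) N ρ) (ampliate (Fin d) M ρ) Λ : EReal) ≤ b := by
  have hX := isTester_contract hρ.1 hΛ
  rw [outcomeQuasi_ampliate]
  obtain ⟨c, hc, hl⟩ := exists_tendsto_testerObj h0 h1 hN hM hX.1
  obtain ⟨Y, hY⟩ := testerObj_mix_bound hE (marginal_posSemidef hρ.1).transpose
    (by rw [trace_transpose, trace_marginal, hρ.2]) (by rwa [trace_transpose_mul]) hX
  refine le_of_tendsto' hl fun j => EReal_ge_of_forall_mix
    (y := testerObj α (choi N) (choi M) Y (c j)) fun ε h h' => ?_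
  obtain ⟨σ, hσ, hσX⟩ := hY ε h h'
  rw [← testerObj_mix]
  exact hb σ k _ _ hσ hσX (hc j)

theorem exists_isPOVM (n : Type) [Fintype n] [DecidableEq n] :
    ∃ Λ : Fin 1 → Matrix n n ℂ, IsPOVM Λ :=
  ⟨fun _ => 1, fun _ => PosSemidef.one, by simp⟩

theorem le_channelQuasi [Nonempty B] (h0 : 0 < α) (h1 : α < 1)
    (hN : (choi N).PosSemidef) (hM : (choi M).PosSemidef) (hE : HasInterior H E) {b : EReal}
    (hb : ∀ (ρ : Matrix A A ℂ) (k : ℕ) (X : Fin k → Matrix (A × B) (A × B) ℂ) (c : Fin k → ℝ),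
      IsInput H E ρ → IsTester ρ X → (∀ x, 0 < c x) →
        b ≤ (testerObj α (choi N) (choi M) X c : EReal)) :
    b ≤ channelQuasi α H E N M := by
  rw [channelQuasi, if_pos h1]
  refine le_iInf fun d => le_iInf fun ρ => le_iInf fun hρ => ?_
  have key := fun (k : ℕ) (Λ : Fin k → Matrix (Fin d × B) (Fin d × B) ℂ) (hΛ : IsPOVM Λ) =>
    le_outcomeQuasi_of_forall h0 h1.ne hN hM hE hb hρ.1 hρ.2 hΛ
  have h2 : b.toENNReal ≤ stateQuasi α (ampliate (Fin d) N ρ) (ampliate (Fin d) M ρ) := by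
    rw [stateQuasi, if_pos h1]
    refine le_iInf fun k => le_iInf fun Λ => le_iInf fun hΛ => ?_
    have := EReal.toENNReal_le_toENNReal (key k Λ hΛ)
    rwa [EReal.toENNReal_coe] at this
  refine le_trans ?_ (EReal.coe_ennreal_le_coe_ennreal_iff.2 h2)
  rw [EReal.coe_toENNReal_eq_max]
  exact le_max_right _ _

theorem channelQuasi_le [Nonempty B] (h1 : 1 < α)
    (hN : (choi N).PosSemidef) (hM : (choi M).PosSemidef) (hE : HasInterior H E) {b : EReal}
    (hb : ∀ (ρ : Matrix A A ℂ) (k : ℕ) (X : Fin k → Matrix (A × B) (A × B) ℂ) (c : Fin k → ℝ),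
      IsInput H E ρ → IsTester ρ X → (∀ x, 0 < c x) →
        (testerObj α (choi N) (choi M) X c : EReal) ≤ b) :
    channelQuasi α H E N M ≤ b := by
  rw [channelQuasi, if_neg h1.not_gt]
  refine iSup_le fun d => iSup_le fun ρ => iSup_le fun hρ => ?_
  have key := fun (k : ℕ) (Λ : Fin k → Matrix (Fin d × B) (Fin d × B) ℂ) (hΛ : IsPOVM Λ) =>
    outcomeQuasi_le_of_forall (by linarith) h1.ne' hN hM hE hb hρ.1 hρ.2 hΛ
  -- Only available once an input state exists: with no input the supremum is `-∞` and `b` may be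
  -- negative.
  have hb0 : 0 ≤ b := by
    obtain ⟨Λ, hΛ⟩ := exists_isPOVM (Fin d × B)
    exact (EReal.coe_ennreal_nonneg _).trans (key 1 Λ hΛ)
  rw [← EReal.coe_toENNReal hb0, EReal.coe_ennreal_le_coe_ennreal_iff, stateQuasi,
    if_neg h1.not_gt]
  refine iSup_le fun k => iSup_le fun Λ => iSup_le fun hΛ => ?_
  have := EReal.toENNReal_le_toENNReal (key k Λ hΛ)
  rwa [EReal.toENNReal_coe] at this

end

end TesterValue

end MeasuredRenyi
namespace MeasuredRenyi

open Matrix Filter Topology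
open scoped MatrixOrder

/-! ### Testers and geometric means -/

section Formulas

variable {A B : Type} [Fintype A] [DecidableEq A] [Fintype B] [DecidableEq B]

/-- Weighted sum of matrices. -/
noncomputable def wsum {n : Type} {k : ℕ} (w : Fin k → ℝ) (X : Fin k → Matrix n n ℂ) :
    Matrix n n ℂ :=
  ∑ x, (w x : ℂ) • X x

theorem wsum_one {n : Type} {k : ℕ} (X : Fin k → Matrix n n ℂ) :
    wsum (fun _ => 1) X = ∑ x, X x := by
  simp [wsum]

theorem trace_wsum_mul {n : Type} [Fintype n] {k : ℕ} (w : Fin k → ℝ) (X : Fin k → Matrix n n ℂ)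
    (P : Matrix n n ℂ) : (wsum w X * P).trace.re = ∑ x, w x * (X x * P).trace.re := by
  simp [wsum, Matrix.sum_mul, trace_sum]

theorem testerObj_eq {n : Type} [Fintype n] {k : ℕ} (α : ℝ) (P Q : Matrix n n ℂ)
    (X : Fin k → Matrix n n ℂ) (c : Fin k → ℝ) :
    testerObj α P Q X c = α * (wsum (fun x => c x ^ (1 - α)) X * P).trace.re +
      (1 - α) * (wsum (fun x => c x ^ (-α)) X * Q).trace.re := by
  simp only [testerObj, scalarObj, trace_wsum_mul, Finset.sum_add_distrib, Finset.mul_sum]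

/-- A Naimark-type dilation: placing factors `K x` of `X x = K x (K x)ᴴ` side by side makes all
weighted sums diagonal in one rectangular frame. -/
theorem exists_frame_wsum {n : Type} [Fintype n] [DecidableEq n] {k : ℕ}
    {X : Fin k → Matrix n n ℂ} (hX : ∀ x, (X x).PosSemidef) :
    ∃ R : Matrix n (Fin k × n) ℂ, ∀ w : Fin k → ℝ, frame R (fun i => w i.1) = wsum w X := by
  choose K hK using fun x => exists_eq_mul_conjTranspose (hX x)
  refine ⟨of fun i j => K j.1 i j.2, fun w => ?_⟩
  ext i j
  rw [frame, Matrix.mul_apply]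
  simp only [wsum, Matrix.sum_apply, mul_diagonal, of_apply,
    conjTranspose_apply, Fintype.sum_prod_type, Matrix.smul_apply, smul_eq_mul]
  refine Finset.sum_congr rfl fun x _ => ?_
  rw [hK x]
  simp only [Matrix.mul_apply, conjTranspose_apply, Finset.mul_sum]
  exact Finset.sum_congr rfl fun y _ => by ring

theorem wsum_posDef {n : Type} [Fintype n] [DecidableEq n] {k : ℕ}
    {X : Fin k → Matrix n n ℂ} (hX : ∀ x, (X x).PosSemidef) (hs : (∑ x, X x).PosDef)
    {w : Fin k → ℝ} (hw : ∀ x, 0 < w x) : (wsum w X).PosDef := by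
  obtain ⟨m, hm, hmw⟩ : ∃ m : ℝ, 0 < m ∧ ∀ x, m ≤ w x := by
    rcases isEmpty_or_nonempty (Fin k) with h | h
    · exact ⟨1, one_pos, fun x => h.elim x⟩
    · obtain ⟨x, hx⟩ := Finite.exists_min w
      exact ⟨w x, hw x, hx⟩
  have : wsum w X = (m : ℂ) • (∑ x, X x) + ∑ x, ((w x - m : ℝ) : ℂ) • X x := by
    rw [Finset.smul_sum, ← Finset.sum_add_distrib, wsum]
    refine Finset.sum_congr rfl fun x _ => ?_
    rw [← add_smul]
    congr 1
    push_cast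
    ring
  rw [this]
  exact (hs.smul (Complex.zero_lt_real.2 hm)).add_posSemidef (posSemidef_sum _ fun x _ =>
    (hX x).smul (Complex.zero_le_real.2 (sub_nonneg.2 (hmw x))))

theorem kronecker_one_posDef {ρ : Matrix A A ℂ} (hρ : ρ.PosDef) :
    (ρ ⊗ₖ (1 : Matrix B B ℂ)).PosDef := hρ.kronecker PosDef.one

theorem IsTester.wsum_posDef {k : ℕ} {ρ : Matrix A A ℂ} {X : Fin k → Matrix (A × B) (A × B) ℂ}
    (hX : IsTester ρ X) (hρ : ρ.PosDef) {w : Fin k → ℝ} (hw : ∀ x, 0 < w x) :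
    (wsum w X).PosDef :=
  MeasuredRenyi.wsum_posDef hX.1 (by rw [hX.2]; exact kronecker_one_posDef hρ) hw

/-- Operator Jensen: `frame_gm_le` for the dilation frame, where weights `1` give `ρ ⊗ I` and
weights `w` give the second argument. -/
theorem IsTester.wsum_le_geoMean {k : ℕ} {ρ : Matrix A A ℂ}
    {X : Fin k → Matrix (A × B) (A × B) ℂ} (hX : IsTester ρ X) (hρ : ρ.PosDef) {w : Fin k → ℝ}
    (hw : ∀ x, 0 < w x) {t : ℝ} (h0 : 0 ≤ t) (h1 : t ≤ 1) :
    wsum (fun x => w x ^ t) X ≤ geoMean t (ρ ⊗ₖ (1 : Matrix B B ℂ)) (wsum w X) := by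
  obtain ⟨S, d, hS, hd, h2, h3, h4⟩ :=
    exists_frame_geoMean (kronecker_one_posDef (B := B) hρ) (hX.wsum_posDef hρ hw)
  obtain ⟨R, hR⟩ := exists_frame_wsum hX.1
  have := frame_gm_le hS (fun _ => one_pos) hd R (a' := fun _ => 1) (b' := fun i => w i.1)
    (fun _ => one_pos) (fun i => hw _) (by rw [hR (fun _ => 1), wsum_one, hX.2, h2])
    (by rw [hR, h3]) h0 h1
  rw [h4, ← hR]
  simpa [gm] using this

theorem IsTester.geoMean_le_wsum {k : ℕ} {ρ : Matrix A A ℂ}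
    {X : Fin k → Matrix (A × B) (A × B) ℂ} (hX : IsTester ρ X) (hρ : ρ.PosDef) {w : Fin k → ℝ}
    (hw : ∀ x, 0 < w x) {t : ℝ} (h0 : t ≤ 0) (h1 : -1 ≤ t) :
    geoMean t (ρ ⊗ₖ (1 : Matrix B B ℂ)) (wsum w X) ≤ wsum (fun x => w x ^ t) X := by
  obtain ⟨S, d, hS, hd, h2, h3, h4⟩ :=
    exists_frame_geoMean (kronecker_one_posDef (B := B) hρ) (hX.wsum_posDef hρ hw)
  obtain ⟨R, hR⟩ := exists_frame_wsum hX.1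
  have := frame_gm_neg_le hS (fun _ => one_pos) hd R (a' := fun _ => 1) (b' := fun i => w i.1)
    (fun _ => one_pos) (fun i => hw _) (by rw [hR (fun _ => 1), wsum_one, hX.2, h2])
    (by rw [hR, h3]) (t := -t) (by linarith) (by linarith)
  rw [h4, ← hR]
  simpa [gm] using this

/-- The tester defined by the spectral decomposition of `Ω` relative to `ρ ⊗ I`. -/
theorem exists_isTester_geoMean {ρ : Matrix A A ℂ} (hρ : ρ.PosDef)
    {Ω : Matrix (A × B) (A × B) ℂ} (hΩ : Ω.PosDef) :
    ∃ (k : ℕ) (X : Fin k → Matrix (A × B) (A × B) ℂ) (w : Fin k → ℝ), IsTester ρ X ∧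
      (∀ x, 0 < w x) ∧ Ω = wsum w X ∧
      ∀ t, geoMean t (ρ ⊗ₖ (1 : Matrix B B ℂ)) Ω = wsum (fun x => w x ^ t) X := by
  obtain ⟨S, d, hS, hd, h2, h3, h4⟩ := exists_frame_geoMean (kronecker_one_posDef (B := B) hρ) hΩ
  let e := Fintype.equivFin (A × B)
  have key : ∀ w : A × B → ℝ, frame S w =
      wsum (fun x => w (e.symm x)) fun x => frame S (Pi.single (e.symm x) 1) := fun w => by
    rw [frame_eq_sum, wsum]
    exact Fintype.sum_equiv e _ _ fun i => by simp
  refine ⟨_, fun x => frame S (Pi.single (e.symm x) 1), fun x => d (e.symm x),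
    ⟨fun x => frame_posSemidef _ fun i => ?_, ?_⟩, fun x => hd _, by rw [h3, key],
    fun t => by rw [h4, key]⟩
  · by_cases h : i = e.symm x
    · subst h
      simp
    · simp [h]
  · rw [h2, key, wsum_one]

/-! ### The variational formulas -/

/-- The objective of the variational formulas. -/
noncomputable def formulaObj {n : Type} [Fintype n] (α : ℝ) (P Q Ω Θ : Matrix n n ℂ) : ℝ :=
  if α < 1 / 2 then α * (Ω * P).trace.re + (1 - α) * (Θ * Q).trace.re
  else α * (Θ * P).trace.re + (1 - α) * (Ω * Q).trace.re

/-- The exponent that relates the parameters of a tester to the weights of `Ω`. -/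
noncomputable def weightExponent (α : ℝ) : ℝ := if α < 1 / 2 then 1 - α else -α

theorem weightExponent_ne_zero {α : ℝ} (h0 : 0 < α) : weightExponent α ≠ 0 := by
  unfold weightExponent
  split_ifs with h
  · linarith
  · linarith

/-- Here `(1 - α) · α/(α-1) = -α` and `-α · (1 - 1/α) = 1 - α`: the two regimes differ only in which
of the two sums is called `Ω`. -/
theorem testerObj_eq_formulaObj {n : Type} [Fintype n] {k : ℕ} {α : ℝ} (h0 : 0 < α)
    (P Q : Matrix n n ℂ) (X : Fin k → Matrix n n ℂ) {c : Fin k → ℝ} (hc : ∀ x, 0 < c x) :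
    testerObj α P Q X c = formulaObj α P Q (wsum (fun x => c x ^ weightExponent α) X)
      (wsum (fun x => (c x ^ weightExponent α) ^ exponent α) X) := by
  rw [testerObj_eq]
  simp only [← Real.rpow_mul (hc _).le]
  unfold formulaObj weightExponent exponent
  split_ifs with h
  · have : (1 - α) * (α / (α - 1)) = -α := by
      have : α - 1 ≠ 0 := by linarith
      field_simp
      ring
    rw [this]
  · have : -α * (1 - 1 / α) = 1 - α := by
      field_simp
      ring
    rw [this]

/-- The reason for the threshold: `α/(α-1) ≥ -1` needs `α ≤ 1/2` and `1 - 1/α ≥ -1` needs `α ≥ 1/2`,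
and the proof of Jensen covers only exponents in `[-1, 1]`. -/
theorem exponent_neg_bounds {α : ℝ} (h0 : 0 < α) (h1 : α < 1) :
    exponent α < 0 ∧ -1 ≤ exponent α := by
  unfold exponent
  split_ifs with h
  · exact ⟨div_neg_of_pos_of_neg h0 (by linarith), by
      rw [le_div_iff_of_neg (by linarith)]; linarith⟩
  · have h2 : 1 < 1 / α := by rwa [lt_div_iff₀ h0, one_mul]
    have h3 : 1 / α ≤ 2 := by rw [div_le_iff₀ h0]; linarith
    exact ⟨by linarith, by linarith⟩

theorem exponent_pos_bounds {α : ℝ} (h1 : 1 < α) : 0 < exponent α ∧ exponent α < 1 := by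
  unfold exponent
  have h0 : 0 < α := by linarith
  rw [if_neg (by linarith)]
  have h2 : 1 / α < 1 := by rwa [div_lt_one h0]
  have h3 : 0 < 1 / α := by positivity
  exact ⟨by linarith, by linarith⟩

theorem trace_mul_re_mono {n : Type} [Fintype n] [DecidableEq n] {X Y P : Matrix n n ℂ}
    (h : X ≤ Y) (hP : P.PosSemidef) : (X * P).trace.re ≤ (Y * P).trace.re := by
  have := trace_mul_re_nonneg (Matrix.le_iff.1 h) hP
  rwa [Matrix.sub_mul, trace_sub, Complex.sub_re, sub_nonneg] at this

/-- `Θ` always carries a positive coefficient, `1 - α` or `α`, also for `α > 1`; so the optimum has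
`Θ` equal to the geometric mean. -/
theorem formulaObj_mono {n : Type} [Fintype n] [DecidableEq n] {α : ℝ} (h0 : 0 < α)
    {P Q Ω Θ Θ' : Matrix n n ℂ} (hP : P.PosSemidef) (hQ : Q.PosSemidef)
    (h : Θ ≤ Θ') : formulaObj α P Q Ω Θ ≤ formulaObj α P Q Ω Θ' := by
  unfold formulaObj
  split_ifs with h2
  · exact add_le_add le_rfl (mul_le_mul_of_nonneg_left (trace_mul_re_mono h hQ) (by linarith))
  · exact add_le_add (mul_le_mul_of_nonneg_left (trace_mul_re_mono h hP) h0.le) le_rfl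

theorem geoMean_posDef {n : Type} [Fintype n] [DecidableEq n] {X Y : Matrix n n ℂ}
    (hX : X.PosDef) (hY : Y.PosDef) (t : ℝ) : (geoMean t X Y).PosDef := by
  obtain ⟨S, d, hS, hd, -, -, h⟩ := exists_frame_geoMean hX hY
  rw [h]
  exact frame_posDef hS fun i => Real.rpow_pos_of_pos (hd i) _

variable {N M : Matrix A A ℂ →ₗ[ℂ] Matrix B B ℂ} {H : Matrix A A ℂ} {E α : ℝ}

/-- Feasible points of the minimization formulas. -/
def MinFeasible (α : ℝ) (H : Matrix A A ℂ) (E : ℝ) (Ω Θ : Matrix (A × B) (A × B) ℂ)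
    (ρ : Matrix A A ℂ) : Prop :=
  Ω.PosDef ∧ Θ.PosDef ∧ ρ.PosDef ∧ ρ.trace = 1 ∧ (H.transpose * ρ).trace.re ≤ E ∧
    (Θ - geoMean (exponent α) (Matrix.kronecker ρ 1) Ω).PosSemidef

/-- Feasible points of the maximization formula. -/
def MaxFeasible (α : ℝ) (H : Matrix A A ℂ) (E : ℝ) (Ω Θ : Matrix (A × B) (A × B) ℂ)
    (ρ : Matrix A A ℂ) : Prop :=
  Ω.PosDef ∧ Θ.PosDef ∧ ρ.PosDef ∧ ρ.trace = 1 ∧ (H.transpose * ρ).trace.re ≤ E ∧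
    (geoMean (exponent α) (Matrix.kronecker ρ 1) Ω - Θ).PosSemidef

/-- Testers and parameters that realize the value of the objective at `Θ = G_t(ρ ⊗ I, Ω)`. -/
theorem exists_testerObj_eq (h0 : 0 < α) {ρ : Matrix A A ℂ} (hρ : ρ.PosDef)
    {Ω : Matrix (A × B) (A × B) ℂ} (hΩ : Ω.PosDef) (P Q : Matrix (A × B) (A × B) ℂ) :
    ∃ (k : ℕ) (X : Fin k → Matrix (A × B) (A × B) ℂ) (c : Fin k → ℝ), IsTester ρ X ∧
      (∀ x, 0 < c x) ∧ testerObj α P Q X c =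
        formulaObj α P Q Ω (geoMean (exponent α) (Matrix.kronecker ρ 1) Ω) := by
  obtain ⟨k, X, w, hX, hw, hΩw, hG⟩ := exists_isTester_geoMean hρ hΩ
  have hc : ∀ x, 0 < w x ^ (1 / weightExponent α) := fun x => Real.rpow_pos_of_pos (hw x) _
  refine ⟨k, X, fun x => w x ^ (1 / weightExponent α), hX, hc, ?_⟩
  rw [testerObj_eq_formulaObj h0 P Q X hc]
  simp only [← Real.rpow_mul (hw _).le, Real.rpow_one,
    one_div, inv_mul_cancel₀ (weightExponent_ne_zero h0)]
  rw [← hΩw]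
  congr 1
  exact (hG _).symm

theorem channelQuasi_eq_iInf [Nonempty B] (h0 : 0 < α) (h1 : α < 1) (hN : (choi N).PosSemidef)
    (hM : (choi M).PosSemidef) (hE : HasInterior H E) :
    channelQuasi α H E N M = ⨅ (Ω : Matrix (A × B) (A × B) ℂ) (Θ : Matrix (A × B) (A × B) ℂ)
      (ρ : Matrix A A ℂ) (_ : MinFeasible α H E Ω Θ ρ),
        (formulaObj α (choi N) (choi M) Ω Θ : EReal) := by
  obtain ⟨ht, ht'⟩ := exponent_neg_bounds h0 h1
  refine le_antisymm ?_ ?_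
  · refine le_iInf fun Ω => le_iInf fun Θ => le_iInf fun ρ => le_iInf fun h => ?_
    obtain ⟨hΩ, hΘ, hρ, hρ1, hρE, hG⟩ := h
    obtain ⟨k, X, c, hX, hc, h⟩ := exists_testerObj_eq h0 hρ hΩ (choi N) (choi M)
    refine (channelQuasi_le_testerObj h0 h1 hN hM ⟨hρ, hρ1, hρE⟩ hX hc).trans ?_
    rw [h, EReal.coe_le_coe_iff]
    exact formulaObj_mono h0 hN hM hG
  · refine le_channelQuasi h0 h1 hN hM hE fun ρ k X c hρ hX hc => ?_
    have hw : ∀ x, 0 < c x ^ weightExponent α := fun x => Real.rpow_pos_of_pos (hc x) _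
    rw [testerObj_eq_formulaObj h0 _ _ X hc]
    exact iInf_le_of_le _ (iInf_le_of_le _ (iInf_le_of_le ρ (iInf_le_of_le
      ⟨hX.wsum_posDef hρ.1 hw, hX.wsum_posDef hρ.1 fun x => Real.rpow_pos_of_pos (hw x) _, hρ.1,
        hρ.2.1, hρ.2.2, hX.geoMean_le_wsum hρ.1 hw ht.le ht'⟩ le_rfl)))

theorem channelQuasi_eq_iSup [Nonempty B] (h1 : 1 < α) (hN : (choi N).PosSemidef)
    (hM : (choi M).PosSemidef) (hE : HasInterior H E) :
    channelQuasi α H E N M = ⨆ (Ω : Matrix (A × B) (A × B) ℂ) (Θ : Matrix (A × B) (A × B) ℂ)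
      (ρ : Matrix A A ℂ) (_ : MaxFeasible α H E Ω Θ ρ),
        (formulaObj α (choi N) (choi M) Ω Θ : EReal) := by
  have h0 : 0 < α := by linarith
  obtain ⟨ht, ht'⟩ := exponent_pos_bounds h1
  refine le_antisymm ?_ ?_
  · refine channelQuasi_le h1 hN hM hE fun ρ k X c hρ hX hc => ?_
    have hw : ∀ x, 0 < c x ^ weightExponent α := fun x => Real.rpow_pos_of_pos (hc x) _
    rw [testerObj_eq_formulaObj h0 _ _ X hc]
    exact le_iSup_of_le _ (le_iSup_of_le _ (le_iSup_of_le ρ (le_iSup_of_le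
      ⟨hX.wsum_posDef hρ.1 hw, hX.wsum_posDef hρ.1 fun x => Real.rpow_pos_of_pos (hw x) _, hρ.1,
        hρ.2.1, hρ.2.2, hX.wsum_le_geoMean hρ.1 hw ht.le ht'.le⟩ le_rfl)))
  · refine iSup_le fun Ω => iSup_le fun Θ => iSup_le fun ρ => iSup_le fun h => ?_
    obtain ⟨hΩ, hΘ, hρ, hρ1, hρE, hG⟩ := h
    obtain ⟨k, X, c, hX, hc, h⟩ := exists_testerObj_eq h0 hρ hΩ (choi N) (choi M)
    refine le_trans ?_ (testerObj_le_channelQuasi h1 hN hM ⟨hρ, hρ1, hρE⟩ hX hc)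
    rw [h, EReal.coe_le_coe_iff]
    exact formulaObj_mono h0 hN hM hG

end Formulas

end MeasuredRenyi
namespace MeasuredRenyi

open Matrix Filter Topology
open scoped MatrixOrder

/-! ### The semidefinite programs -/

section Programs

theorem SDP.Feasible.mix {V n J : Type} [AddCommGroup V] [Module ℝ V] {P : SDP V n J}
    {x y : V} (hx : P.Feasible x) (hy : P.Feasible y) {ε : ℝ} (h0 : 0 ≤ ε) (h1 : ε ≤ 1) :
    P.Feasible ((1 - ε) • x + ε • y) := by
  intro j
  have h := ((hx j).smul (sub_nonneg.2 h1)).add ((hy j).smul h0)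
  convert h using 1
  rw [map_add, map_smul, map_smul]
  module

theorem smul_one_posSemidef_iff {n : Type} [Fintype n] [DecidableEq n] [Nonempty n] {r : ℝ} :
    (r • (1 : Matrix n n ℂ)).PosSemidef ↔ 0 ≤ r := by
  refine ⟨fun h => ?_, fun h => PosSemidef.one.smul h⟩
  have := h.diag_nonneg (i := Classical.arbitrary n)
  simpa using this

variable {A B : Type} [Fintype A] [DecidableEq A] [Nonempty A] [Fintype B] [DecidableEq B]
  [Nonempty B]

theorem channelSDP_feasible_iff {k m : ℕ} (L : Fin m → BlockLMI k) (α : ℝ) (H : Matrix A A ℂ)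
    (E : ℝ) (P Q : Matrix (A × B) (A × B) ℂ) (v : ChannelVars A B k) :
    (channelSDP L α H E P Q).Feasible v ↔ (∀ j, ((L j).eval v).PosSemidef) ∧
      (v.1 : Matrix A A ℂ).trace.re = 1 ∧ (Hᵀ * (v.1 : Matrix A A ℂ)).trace.re ≤ E := by
  have h : ∀ (r : ℝ) (f : ChannelVars A B k →ₗ[ℝ] ℝ),
      (r • (1 : Matrix (Fin 2 × (A × B)) (Fin 2 × (A × B)) ℂ) + scalarLin _ f v).PosSemidef ↔
        0 ≤ r + f v := fun r f => by
    rw [scalarLin, LinearMap.smulRight_apply, ← add_smul, smul_one_posSemidef_iff]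
  rw [SDP.Feasible, Sum.forall, Fin.forall_fin_succ, Fin.forall_fin_succ, Fin.forall_fin_succ]
  have e1 : (∀ j, ((channelSDP L α H E P Q).const (Sum.inl j) +
      (channelSDP L α H E P Q).lin (Sum.inl j) v).PosSemidef) ↔
      ∀ j, ((L j).eval v).PosSemidef := by
    simp [channelSDP]
  rw [e1]
  have e2 := h (-1) (trFun 1 ∘ₗ LinearMap.fst ℝ _ _)
  have e3 := h 1 (-(trFun 1 ∘ₗ LinearMap.fst ℝ _ _))
  have e4 := h E (-(trFun H.transpose ∘ₗ LinearMap.fst ℝ _ _))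
  refine and_congr_right fun _ => ?_
  refine (and_congr e2 (and_congr e3 (and_congr_left fun _ => e4))).trans ?_
  simp only [LinearMap.neg_apply, LinearMap.comp_apply, LinearMap.fst_apply, trFun,
    LinearMap.coe_mk, AddHom.coe_mk, Matrix.one_mul, IsEmpty.forall_iff, and_true]
  constructor
  · rintro ⟨h1, h2, h3⟩
    exact ⟨by linarith, by linarith⟩
  · rintro ⟨h1, h2⟩
    exact ⟨by linarith, by linarith, by linarith⟩

theorem channelSDP_obj {k m : ℕ} (L : Fin m → BlockLMI k) (α : ℝ) (H : Matrix A A ℂ)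
    (E : ℝ) (P Q : Matrix (A × B) (A × B) ℂ) (v : ChannelVars A B k) :
    (channelSDP L α H E P Q).obj v = formulaObj α P Q (v.2.1 : Matrix (A × B) (A × B) ℂ)
      (v.2.2.1 : Matrix (A × B) (A × B) ℂ) := by
  simp only [channelSDP, channelObj, formulaObj]
  split_ifs <;> simp [trFun, trace_mul_comm P, trace_mul_comm Q]

theorem posSemidef_of_kronecker_one {ρ : Matrix A A ℂ}
    (h : (ρ ⊗ₖ (1 : Matrix B B ℂ)).PosSemidef) : ρ.PosSemidef := by
  have := h.submatrix fun a : A => (a, Classical.arbitrary B)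
  convert this using 1
  ext a a'
  simp

theorem IsHermitian.trace_eq_one {ρ : Matrix A A ℂ} (h : ρ.IsHermitian) (h1 : ρ.trace.re = 1) :
    ρ.trace = 1 := by
  have h2 : star ρ.trace = ρ.trace := by rw [← trace_conjTranspose, h.eq]
  refine Complex.ext (by simpa using h1) ?_
  have := congrArg Complex.im h2
  simp only [Complex.star_def, Complex.conj_im] at this
  rw [Complex.one_im]
  linarith

/-- The relation represented by the block inequalities of the program. -/
def ProgramRel (α : ℝ) (p q : ℕ) (n : Type) [Fintype n] [DecidableEq n]
    (v : Fin 3 → Matrix n n ℂ) : Prop :=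
  if α < 1 then Epi p q (v 0) (v 1) (v 2) else Hyp p q (v 0) (v 1) (v 2)

theorem lmiRep_programRel (α : ℝ) (p q : ℕ) :
    LMIRep (Fin 3) (2 * Nat.log 2 q + 6) (ProgramRel α p q) := by
  unfold ProgramRel
  split_ifs
  · exact lmiRep_epi p q 0 1 2
  · exact lmiRep_hyp p q 0 1 2

theorem ProgramRel.posSemidef {α : ℝ} {p q : ℕ} {n : Type} [Fintype n] [DecidableEq n]
    {v : Fin 3 → Matrix n n ℂ} (h : ProgramRel α p q n v) :
    (v 0).PosSemidef ∧ (v 1).PosSemidef := by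
  unfold ProgramRel at h
  split_ifs at h <;> obtain ⟨Z, -, h, -⟩ := h <;> exact h.posSemidef

variable {k m : ℕ} {L : Fin m → BlockLMI k} {N M : Matrix A A ℂ →ₗ[ℂ] Matrix B B ℂ}
  {H : Matrix A A ℂ} {E α : ℝ} {p q : ℕ}

/-- Feasible points of the program can be mixed with a strictly feasible one. -/
theorem exists_strictly_feasible (P Q : Matrix (A × B) (A × B) ℂ)
    (hL : ∀ (ρ : Herm A) (Ω Θ : Herm (A × B)),
      ProgramRel α p q (A × B) ![(ρ : Matrix A A ℂ) ⊗ₖ (1 : Matrix B B ℂ), Ω, Θ] ↔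
        ∃ Z : Fin k → Herm (A × B), ∀ j, ((L j).eval (ρ, Ω, Θ, Z)).PosSemidef)
    (hE : HasInterior H E)
    (hrel : ∀ X Y : Matrix (A × B) (A × B) ℂ, X.PosDef → Y.PosDef →
      ProgramRel α p q (A × B) ![X, Y, geoMean (exponent α) X Y])
    {v : ChannelVars A B k} (hv : (channelSDP L α H E P Q).Feasible v) :
    ∃ y : ℝ, ∀ ε : ℝ, 0 < ε → ε ≤ 1 → ∃ w : ChannelVars A B k,
      (1 - ε) * (channelSDP L α H E P Q).obj v + ε * y = (channelSDP L α H E P Q).obj w ∧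
      IsInput H E (w.1 : Matrix A A ℂ) ∧ (w.2.1 : Matrix (A × B) (A × B) ℂ).PosDef ∧
      ProgramRel α p q (A × B) ![(w.1 : Matrix A A ℂ) ⊗ₖ (1 : Matrix B B ℂ), w.2.1, w.2.2.1] := by
  obtain ⟨ρ, Ω, Θ, Z⟩ := v
  obtain ⟨h1, h2, h3⟩ := (channelSDP_feasible_iff L α H E P Q _).1 hv
  obtain ⟨hρ, hΩ⟩ := ((hL ρ Ω Θ).2 ⟨Z, h1⟩).posSemidef
  have hρ' : (ρ : Matrix A A ℂ).PosSemidef := posSemidef_of_kronecker_one hρ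
  have hρ1 := IsHermitian.trace_eq_one (herm_isHermitian ρ) h2
  obtain ⟨τ, hτ⟩ := hE.exists_isInput (ρ := (ρ : Matrix A A ℂ)ᵀ)
    ⟨hρ'.transpose, by rw [trace_transpose, hρ1]⟩
    (by rw [← trace_transpose_mul, transpose_transpose]; exact h3)
  have hτk := kronecker_one_posDef (B := B) hτ.1
  let τ' : Herm A := ⟨τ, hτ.1.1⟩
  let Ω₀ : Herm (A × B) := ⟨1, isHermitian_one⟩
  let Θ₀ : Herm (A × B) := ⟨geoMean (exponent α) (τ ⊗ₖ (1 : Matrix B B ℂ)) 1,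
    (geoMean_posDef hτk PosDef.one _).1⟩
  -- The base point is an interior input `τ` with `Ω = 1` and `Θ` the corresponding mean; `y` is its
  -- objective value.
  obtain ⟨Z₀, hZ₀⟩ := (hL τ' Ω₀ Θ₀).1 (hrel _ _ hτk PosDef.one)
  have hv₀ : (channelSDP L α H E P Q).Feasible (τ', Ω₀, Θ₀, Z₀) := by
    rw [channelSDP_feasible_iff]
    exact ⟨hZ₀, by rw [show ((τ' : Matrix A A ℂ)).trace = 1 from hτ.2.1]; rfl, hτ.2.2⟩
  refine ⟨(channelSDP L α H E P Q).obj (τ', Ω₀, Θ₀, Z₀), fun ε h0 h0' =>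
    ⟨(1 - ε) • (ρ, Ω, Θ, Z) + ε • (τ', Ω₀, Θ₀, Z₀), ?_, ?_, ?_, ?_⟩⟩
  · rw [map_add, map_smul, map_smul]
    rfl
  · have := hτ.mix hρ' hρ1 h3 h0 h0'
    convert this using 1
    ext i j
    simp [τ']
  · have : (((1 - ε : ℝ) : ℂ) • (Ω : Matrix (A × B) (A × B) ℂ) + (ε : ℂ) • 1).PosDef :=
      PosDef.posSemidef_add (hΩ.smul (Complex.zero_le_real.2 (sub_nonneg.2 h0')))
        (PosDef.one.smul (Complex.zero_lt_real.2 h0))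
    convert this using 1
    ext i j
    simp [Ω₀]
  · have hw := ((channelSDP_feasible_iff L α H E P Q _).1 (hv.mix hv₀ h0.le h0')).1
    exact (hL _ _ _).2 ⟨_, hw⟩

/-- The program also admits singular `ρ` and `Ω`, where the block relation is not identified with
`G_t`. Mixing with a strictly feasible point brings every feasible point into the positive definite
region at arbitrarily small cost. -/
theorem channelQuasi_eq_minValue (h0 : 0 < α) (h1 : α < 1) (hq : 0 < q) (hpq : p ≤ q)
    (ht : exponent α = -(p / q)) (hN : (choi N).PosSemidef) (hM : (choi M).PosSemidef)
    (hE : HasInterior H E)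
    (hL : ∀ (ρ : Herm A) (Ω Θ : Herm (A × B)),
      ProgramRel α p q (A × B) ![(ρ : Matrix A A ℂ) ⊗ₖ (1 : Matrix B B ℂ), Ω, Θ] ↔
        ∃ Z : Fin k → Herm (A × B), ∀ j, ((L j).eval (ρ, Ω, Θ, Z)).PosSemidef) :
    channelQuasi α H E N M = (channelSDP L α H E (choi N) (choi M)).minValue := by
  have hrel : ∀ X Y T : Matrix (A × B) (A × B) ℂ, X.PosDef → Y.PosDef →
      (ProgramRel α p q (A × B) ![X, Y, T] ↔ geoMean (exponent α) X Y ≤ T) := by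
    intro X Y T hX hY
    rw [ht, ← epi_iff hX hY hq hpq, ProgramRel, if_pos h1]
    rfl
  rw [channelQuasi_eq_iInf h0 h1 hN hM hE, SDP.minValue]
  refine le_antisymm ?_ ?_
  · refine le_iInf fun v => le_iInf fun hv => ?_
    obtain ⟨y, hy⟩ := exists_strictly_feasible _ _ hL hE
      (fun X Y hX hY => (hrel X Y _ hX hY).2 le_rfl) hv
    refine EReal_le_of_forall_mix (y := y) fun ε hε hε1 => ?_
    obtain ⟨w, hw, hρ, hΩ, hR⟩ := hy ε hε hε1
    have hXk := kronecker_one_posDef (B := B) hρ.1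
    have hG := (hrel _ _ _ hXk hΩ).1 hR
    rw [hw, channelSDP_obj]
    refine iInf_le_of_le _ (iInf_le_of_le _ (iInf_le_of_le _ (iInf_le_of_le
      ⟨hΩ, ?_, hρ.1, hρ.2.1, hρ.2.2, hG⟩ le_rfl)))
    -- `Θ` is positive definite automatically, being above a positive definite mean.
    have := (geoMean_posDef hXk hΩ (exponent α)).add_posSemidef (Matrix.le_iff.1 hG)
    rwa [add_sub_cancel] at this
  · refine le_iInf fun Ω => le_iInf fun Θ => le_iInf fun ρ => le_iInf fun h => ?_
    obtain ⟨hΩ, hΘ, hρ, hρ1, hρE, hG⟩ := h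
    obtain ⟨Z, hZ⟩ := (hL ⟨ρ, hρ.1⟩ ⟨Ω, hΩ.1⟩ ⟨Θ, hΘ.1⟩).1
      ((hrel _ _ _ (kronecker_one_posDef hρ) hΩ).2 hG)
    refine iInf_le_of_le (⟨ρ, hρ.1⟩, ⟨Ω, hΩ.1⟩, ⟨Θ, hΘ.1⟩, Z) (iInf_le_of_le ?_ ?_)
    · rw [channelSDP_feasible_iff]
      exact ⟨hZ, by rw [hρ1]; rfl, hρE⟩
    · rw [channelSDP_obj]

theorem channelQuasi_eq_maxValue (h1 : 1 < α) (hq : 0 < q) (hpq : p ≤ q)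
    (ht : exponent α = p / q) (hN : (choi N).PosSemidef) (hM : (choi M).PosSemidef)
    (hE : HasInterior H E)
    (hL : ∀ (ρ : Herm A) (Ω Θ : Herm (A × B)),
      ProgramRel α p q (A × B) ![(ρ : Matrix A A ℂ) ⊗ₖ (1 : Matrix B B ℂ), Ω, Θ] ↔
        ∃ Z : Fin k → Herm (A × B), ∀ j, ((L j).eval (ρ, Ω, Θ, Z)).PosSemidef) :
    channelQuasi α H E N M = (channelSDP L α H E (choi N) (choi M)).maxValue := by
  have hrel : ∀ X Y T : Matrix (A × B) (A × B) ℂ, X.PosDef → Y.PosDef →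
      (ProgramRel α p q (A × B) ![X, Y, T] ↔ T ≤ geoMean (exponent α) X Y) := by
    intro X Y T hX hY
    rw [ht, ← hyp_iff hX hY hq hpq, ProgramRel, if_neg h1.not_gt]
    rfl
  rw [channelQuasi_eq_iSup h1 hN hM hE, SDP.maxValue]
  refine le_antisymm ?_ ?_
  · refine iSup_le fun Ω => iSup_le fun Θ => iSup_le fun ρ => iSup_le fun h => ?_
    obtain ⟨hΩ, hΘ, hρ, hρ1, hρE, hG⟩ := h
    obtain ⟨Z, hZ⟩ := (hL ⟨ρ, hρ.1⟩ ⟨Ω, hΩ.1⟩ ⟨Θ, hΘ.1⟩).1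
      ((hrel _ _ _ (kronecker_one_posDef hρ) hΩ).2 hG)
    refine le_iSup_of_le (⟨ρ, hρ.1⟩, ⟨Ω, hΩ.1⟩, ⟨Θ, hΘ.1⟩, Z) (le_iSup_of_le ?_ ?_)
    · rw [channelSDP_feasible_iff]
      exact ⟨hZ, by rw [hρ1]; rfl, hρE⟩
    · rw [channelSDP_obj]
  · refine iSup_le fun v => iSup_le fun hv => ?_
    obtain ⟨y, hy⟩ := exists_strictly_feasible _ _ hL hE
      (fun X Y hX hY => (hrel X Y _ hX hY).2 le_rfl) hv
    refine EReal_ge_of_forall_mix (y := y) fun ε hε hε1 => ?_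
    obtain ⟨w, hw, hρ, hΩ, hR⟩ := hy ε hε hε1
    have hXk := kronecker_one_posDef (B := B) hρ.1
    have hG := (hrel _ _ _ hXk hΩ).1 hR
    rw [hw, channelSDP_obj]
    -- For the maximum `Θ` need not be positive; it is replaced by the mean, which is and does not
    -- lower the objective.
    refine le_trans (EReal.coe_le_coe_iff.2 (formulaObj_mono (by linarith) hN hM hG)) ?_
    exact le_iSup_of_le _ (le_iSup_of_le _ (le_iSup_of_le _ (le_iSup_of_le
      ⟨hΩ, geoMean_posDef hXk hΩ _, hρ.1, hρ.2.1, hρ.2.2,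
        Matrix.le_iff.1 (le_refl (geoMean (exponent α) _ _))⟩ le_rfl)))

/-- Six plus the three scalar constraints give the constant `9`, which dominates the slope `2`. -/
theorem numLMI_bound (q : ℕ) :
    (((2 * Nat.log 2 q + 6 + 3 : ℕ) : ℝ)) ≤ 9 * (1 + Real.logb 2 (q : ℝ)) := by
  have h : (Nat.log 2 q : ℝ) ≤ Real.logb 2 q := by
    have := Real.natLog_le_logb q 2
    simpa using this
  have h' : (0 : ℝ) ≤ Nat.log 2 q := Nat.cast_nonneg _
  push_cast
  linarith

end Programs

end MeasuredRenyi

open MeasuredRenyi in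
theorem proposition10 :
    -- the variational formulas
    (∀ (A B : Type) [Fintype A] [DecidableEq A] [Nonempty A]
        [Fintype B] [DecidableEq B] [Nonempty B]
        (N M : Matrix A A ℂ →ₗ[ℂ] Matrix B B ℂ) (H : Matrix A A ℂ) (E : ℝ) (α : ℝ),
      IsChannel N → IsCompletelyPositive M → H.IsHermitian →
      ((∃ ρ : Matrix A A ℂ, IsDensity ρ ∧ (H * ρ).trace.re ≤ E) →
        ∃ ρ : Matrix A A ℂ, IsDensity ρ ∧ (H * ρ).trace.re ≤ E ∧ ρ.PosDef) →
      (0 < α → α < 1 / 2 →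
        channelQuasi α H E N M =
          ⨅ (Ω : Matrix (A × B) (A × B) ℂ) (Θ : Matrix (A × B) (A × B) ℂ) (ρ : Matrix A A ℂ)
            (_ : Ω.PosDef ∧ Θ.PosDef ∧ ρ.PosDef ∧ ρ.trace = 1 ∧
              (H.transpose * ρ).trace.re ≤ E ∧
              (Θ - geoMean (α / (α - 1)) (Matrix.kronecker ρ 1) Ω).PosSemidef),
            ((α * (Ω * choi N).trace.re + (1 - α) * (Θ * choi M).trace.re : ℝ) : EReal)) ∧
      (1 / 2 ≤ α → α < 1 →
        channelQuasi α H E N M =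
          ⨅ (Ω : Matrix (A × B) (A × B) ℂ) (Θ : Matrix (A × B) (A × B) ℂ) (ρ : Matrix A A ℂ)
            (_ : Ω.PosDef ∧ Θ.PosDef ∧ ρ.PosDef ∧ ρ.trace = 1 ∧
              (H.transpose * ρ).trace.re ≤ E ∧
              (Θ - geoMean (1 - 1 / α) (Matrix.kronecker ρ 1) Ω).PosSemidef),
            ((α * (Θ * choi N).trace.re + (1 - α) * (Ω * choi M).trace.re : ℝ) : EReal)) ∧
      (1 < α →
        channelQuasi α H E N M =
          ⨆ (Ω : Matrix (A × B) (A × B) ℂ) (Θ : Matrix (A × B) (A × B) ℂ) (ρ : Matrix A A ℂ)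
            (_ : Ω.PosDef ∧ Θ.PosDef ∧ ρ.PosDef ∧ ρ.trace = 1 ∧
              (H.transpose * ρ).trace.re ≤ E ∧
              (geoMean (1 - 1 / α) (Matrix.kronecker ρ 1) Ω - Θ).PosSemidef),
            ((α * (Θ * choi N).trace.re + (1 - α) * (Ω * choi M).trace.re : ℝ) : EReal))) ∧
    -- the semidefinite program, with `O(log₂ q)` matrix inequalities
    (∃ C : ℝ, ∀ (α : ℚ) (p q : ℤ), 0 < α → α ≠ 1 → 0 < q → IsCoprime p q →
      (p : ℝ) / (q : ℝ) = exponent (α : ℝ) →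
      ∃ (k m : ℕ) (L : Fin m → BlockLMI k),
        ∀ (A B : Type) [Fintype A] [DecidableEq A] [Nonempty A]
          [Fintype B] [DecidableEq B] [Nonempty B]
          (N M : Matrix A A ℂ →ₗ[ℂ] Matrix B B ℂ) (H : Matrix A A ℂ) (E : ℝ),
        IsChannel N → IsCompletelyPositive M → H.IsHermitian →
        ((∃ ρ : Matrix A A ℂ, IsDensity ρ ∧ (H * ρ).trace.re ≤ E) →
          ∃ ρ : Matrix A A ℂ, IsDensity ρ ∧ (H * ρ).trace.re ≤ E ∧ ρ.PosDef) →
        ((channelSDP L (α : ℝ) H E (choi N) (choi M)).numLMI : ℝ)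
            ≤ C * (1 + Real.logb 2 (q : ℝ)) ∧
        (channelSDP L (α : ℝ) H E (choi N) (choi M)).sizeLMI
            = 2 * Fintype.card A * Fintype.card B ∧
        (α < 1 → channelQuasi (α : ℝ) H E N M =
          (channelSDP L (α : ℝ) H E (choi N) (choi M)).minValue) ∧
        (1 < α → channelQuasi (α : ℝ) H E N M =
          (channelSDP L (α : ℝ) H E (choi N) (choi M)).maxValue)) := by
  refine ⟨fun A B _ _ _ _ _ _ N M H E α hN hM _ hE => ⟨fun h0 h1 => ?_, fun h0 h1 => ?_,
    fun h1 => ?_⟩, 9, fun α p q hα hα1 hq _ hpq => ?_⟩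
  · rw [channelQuasi_eq_iInf h0 (by linarith) (choi_posSemidef hN.1) (choi_posSemidef hM) hE]
    simp only [MinFeasible, formulaObj, exponent, if_pos h1]
  · rw [channelQuasi_eq_iInf (by linarith) h1 (choi_posSemidef hN.1) (choi_posSemidef hM) hE]
    simp only [MinFeasible, formulaObj, exponent, if_neg h0.not_gt]
  · rw [channelQuasi_eq_iSup h1 (choi_posSemidef hN.1) (choi_posSemidef hM) hE]
    simp only [MaxFeasible, formulaObj, exponent, if_neg (show ¬ α < 1 / 2 by linarith)]
  · obtain ⟨q, rfl⟩ := Int.eq_ofNat_of_zero_le hq.le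
    have hq' : 0 < q := by exact_mod_cast hq
    have hqR : (0 : ℝ) < q := by exact_mod_cast hq'
    have hαR : (0 : ℝ) < (α : ℝ) := by exact_mod_cast hα
    rw [Int.cast_natCast] at hpq
    -- For `α < 1` the exponent, hence `p`, is negative: the sign selects epigraph or hypograph, and
    -- only `|p| / q ≤ 1` enters the blocks.
    obtain ⟨k, L, hL⟩ := (lmiRep_programRel (α : ℝ) p.natAbs q).exists_blockLMI
    refine ⟨k, _, L, fun A B _ _ _ _ _ _ N M H E hN hM _ hE => ⟨?_, ?_, fun h1 => ?_, fun h1 => ?_⟩⟩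
    · have := numLMI_bound q
      simpa [SDP.numLMI] using this
    · simp [SDP.sizeLMI, mul_assoc]
    · have h1' : (α : ℝ) < 1 := by exact_mod_cast h1
      obtain ⟨ht, ht'⟩ := exponent_neg_bounds hαR h1'
      have hp : (p : ℝ) < 0 := by
        rw [← hpq] at ht
        exact (div_neg_iff.1 ht).elim (fun h => absurd h.2 hqR.not_gt) fun h => h.1
      have hpa : ((p.natAbs : ℕ) : ℝ) = -p := by
        rw [Nat.cast_natAbs, Int.cast_abs, abs_of_neg hp]
      refine channelQuasi_eq_minValue hαR h1' hq' ?_ ?_ (choi_posSemidef hN.1)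
        (choi_posSemidef hM) hE (hL A B)
      · rw [← hpq, le_div_iff₀ hqR] at ht'
        have : ((p.natAbs : ℕ) : ℝ) ≤ q := by rw [hpa]; linarith
        exact_mod_cast this
      · rw [hpa, ← hpq]
        ring
    · have h1' : 1 < (α : ℝ) := by exact_mod_cast h1
      obtain ⟨ht, ht'⟩ := exponent_pos_bounds h1'
      have hp : 0 < (p : ℝ) := by
        rw [← hpq] at ht
        exact (div_pos_iff_of_pos_right hqR).1 ht
      have hpa : ((p.natAbs : ℕ) : ℝ) = p := by
        rw [Nat.cast_natAbs, Int.cast_abs, abs_of_pos hp]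
      refine channelQuasi_eq_maxValue h1' hq' ?_ ?_ (choi_posSemidef hN.1)
        (choi_posSemidef hM) hE (hL A B)
      · rw [← hpq, div_lt_one hqR] at ht'
        have : ((p.natAbs : ℕ) : ℝ) ≤ q := by rw [hpa]; exact ht'.le
        exact_mod_cast this
      · rw [hpa, ← hpq]
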